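/- Let $P$ be a real rational $q\times m$ transfer matrix of relative degree greater than zero (every entry strictly proper) and let $K$ be a proper real rational $m\times q$ transfer matrix. For $i=1,\dots,m$ let channel $i$ have random delays $\chi_{i,k}\in\{0,\dots,\bar\chi_i\}$ with $\Pr\{\chi_{i,k}=j\}=p_{ij}$, $\sum_{j}p_{ij}=1$, independent over all $i$ and $k$, and let $\alpha_{i,j}\ge 0$ be receiver weights. Consider the feedback loop, at rest before time $0$, \[ y=P(v-u_d),\qquad u=Ky,\qquad u_{di}(k)=\sum_{j=0}^{\bar\chi_i}h_i(k,k-j)\,u_i(k-j),\qquad h_i(n+j,n)=\begin{cases}\alpha_{i,j}&\text{if }\chi_{i,n}=j,\\0&\text{otherwise,}\end{cases} \] and put $\mu_{i,j}=\mathbb E\,h_i(n+j,n)$, $r_{i,jl}=\operatorname{Cov}(h_i(n+j,n),h_i(n+l,n))$, $H_i(z)=\sum_{j=0}^{\bar\chi_i}\mu_{i,j}z^{-j}$, $H=\operatorname{diag}(H_1,\dots,H_m)$, and \[ d_i(k)=\sum_{j=0}^{\bar\chi_i}\bigl(h_i(k,k-j)-\mu_{i,j}\bigr)u_i(k-j),\qquad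 e=v-d . \] Assume $H_i\neq 0$ for every $i$. Let $S_{\Omega_i}(z)=\sum_{|\lambda|\le\bar\chi_i}r_i(|\lambda|)z^{-\lambda}$ with $r_i(\lambda)=\sum_{j=0}^{\bar\chi_i-\lambda}r_{i,j(j+\lambda)}$, and let $\Phi_i$ be a spectral factor of it: a real polynomial in $z^{-1}$ of order at most $\bar\chi_i$ with $\Phi_i(z)\Phi_i(z^{-1})=S_{\Omega_i}(z)$ that is zero or has no zeros in $|z|>1$, $z=\infty$ included. Put \[ T=K(I+PHK)^{-1}PH,\qquad W_i=H_i^{-1}\Phi_i . \] The nominal loop is called internally stable if $K(I+PHK)^{-1}P$, $K(I+PHK)^{-1}$, $(I+PHK)^{-1}P$ and $(I+PHK)^{-1}$ are proper with all poles in $|z|<1$. The stochastic loop is called mean-square internally stable if the nominal loop is internally stable and, for every i.i.d. zero-mean input $\{v(k)\}_{k\ge0}$ with finite diagonal covariance matrix that is independent of the delays, the matrices $\mathbb E\{e(k)e^T(k)\}$ and $\mathbb E\{u(k)u^T(k)\}$ are bounded uniformly in $k$. Then the stochastic loop is mean-square internally stable if and only if the nominal loop is internally stable and \[ \rho(\widehat{TW})<1,\qquad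 \widehat{TW}=\bigl(\|T_{i_1i_2}W_{i_2}\|_2^2\bigr)_{i_1,i_2=1}^m,\qquad \|F\|_2^2=\frac1{2\pi}\int_{-\pi}^{\pi}|F(e^{j\theta})|^2\,d\theta . \] In particular, for a controller $K$ that internally stabilizes the nominal loop, the stochastic loop is mean-square internally stable if and only if $\rho(\widehat{TW})<1$. -/

import Mathlib

open MeasureTheory ProbabilityTheory

noncomputable section

namespace RandomDelay

/-! Transfer functions are real rational functions written in the delay variable `ζ = z⁻¹`, so
`RatFunc.X` stands for `z⁻¹`.  Thus `z = ∞` is `ζ = 0`, the region `|z| ≥ 1` (with `∞`) is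
`|ζ| ≤ 1`, and the Laurent expansion at `z = ∞` is the power series expansion at `ζ = 0`. -/

/-- A transfer function is proper: it is finite at `z = ∞`. -/
def IsProper (f : RatFunc ℝ) : Prop := f.denom.eval 0 ≠ 0

/-- A transfer function has relative degree greater than zero: it vanishes at `z = ∞`. -/
def IsStrictlyProper (f : RatFunc ℝ) : Prop := IsProper f ∧ f.num.eval 0 = 0

/-- `f ∈ RH∞`: proper, with all its poles in `|z| < 1`. -/
def IsRHInf (f : RatFunc ℝ) : Prop :=
  ∀ ζ : ℂ, ‖ζ‖ ≤ 1 → Polynomial.aeval ζ f.denom ≠ 0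

/-- The squared `H₂` norm `(1 / 2π) ∫ |F(e^{jθ})|² dθ` over `[-π, π]`
(used for stable proper transfer functions). -/
def h2NormSq (f : RatFunc ℝ) : ℝ :=
  (2 * Real.pi)⁻¹ * ∫ θ in (-Real.pi)..Real.pi,
    ‖f.eval (algebraMap ℝ ℂ) (Complex.exp (-(θ * Complex.I)))‖ ^ 2

/-- The impulse response of a proper transfer function: the coefficient of `z⁻ⁿ`. -/
def impulseResponse (f : RatFunc ℝ) (n : ℕ) : ℝ :=
  (f : LaurentSeries ℝ).coeff (n : ℤ)

/-- The response at time `k` of the LTI system with transfer matrix `F`, at rest before time `0`,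
to the input `x`. -/
def ltiOutput {a b : ℕ} (F : Matrix (Fin a) (Fin b) (RatFunc ℝ)) (x : ℕ → Fin b → ℝ)
    (k : ℕ) : Fin a → ℝ :=
  fun i => ∑ n ∈ Finset.range (k + 1), ∑ j, impulseResponse (F i j) (k - n) * x n j

/-- The data of one random delay channel: delays take values in `{0, …, maxDelay}`, delay `j` has
probability `prob j`, and a datum that arrives with delay `j` gets the weight `weight j`. -/
structure Channel where
  maxDelay : ℕ
  weight : ℕ → ℝ
  weight_nonneg : ∀ j ≤ maxDelay, 0 ≤ weight j
  prob : ℕ → ℝ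
  prob_nonneg : ∀ j ≤ maxDelay, 0 ≤ prob j
  prob_sum : ∑ j ∈ Finset.range (maxDelay + 1), prob j = 1

namespace Channel

variable (c : Channel)

/-- `h(n + j, n)`: the response, `j` steps later, to a unit impulse that is sent with delay `x`. -/
def resp (x j : ℕ) : ℝ := if x = j then c.weight j else 0

/-- The mean `μ_j` of `h(n + j, n)`. -/
def mean (j : ℕ) : ℝ := ∑ x ∈ Finset.range (c.maxDelay + 1), c.prob x * c.resp x j

/-- The covariance `r_{jl}` of `h(n + j, n)` and `h(n + l, n)`. -/
def cov (j l : ℕ) : ℝ :=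
  ∑ x ∈ Finset.range (c.maxDelay + 1),
    c.prob x * ((c.resp x j - c.mean j) * (c.resp x l - c.mean l))

/-- The output of the channel `Δ_i` for the delays `χ` and the input `u` (zero before time `0`). -/
def output (χ : ℕ → ℕ) (u : ℕ → ℝ) (k : ℕ) : ℝ :=
  ∑ j ∈ Finset.range (c.maxDelay + 1), if j ≤ k then c.resp (χ (k - j)) j * u (k - j) else 0

/-- The output of the zero-mean part `Ω_i` of the channel. -/
def uncertaintyOutput (χ : ℕ → ℕ) (u : ℕ → ℝ) (k : ℕ) : ℝ :=
  ∑ j ∈ Finset.range (c.maxDelay + 1),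
    if j ≤ k then (c.resp (χ (k - j)) j - c.mean j) * u (k - j) else 0

/-- The nominal channel `H_i(z) = ∑ μ_j z⁻ʲ`. -/
def nominal : RatFunc ℝ :=
  ∑ j ∈ Finset.range (c.maxDelay + 1), RatFunc.C (c.mean j) * RatFunc.X ^ j

/-- `r(l) = ∑_{j = 0}^{maxDelay - l} r_{j, j + l}` for `0 ≤ l ≤ maxDelay`. -/
def autoCov (l : ℕ) : ℝ := ∑ j ∈ Finset.range (c.maxDelay - l + 1), c.cov j (j + l)

/-- The energy spectral density `S_Ω(z) = ∑_{|l| ≤ maxDelay} r(|l|) z^{-l}`. -/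
def spectralDensity : RatFunc ℝ :=
  ∑ l ∈ Finset.Icc (-(c.maxDelay : ℤ)) c.maxDelay,
    RatFunc.C (c.autoCov l.natAbs) * RatFunc.X ^ l

/-- `Φ` (a polynomial in `z⁻¹` of order at most `maxDelay`) is a spectral factor:
`S_Ω(z) = Φ(z) Φ(z⁻¹)` and `Φ` is minimum phase, i.e. without zeros in `|z| > 1` (with `∞`).
The zero polynomial is admitted, for a channel without uncertainty. -/
structure IsSpectralFactor (Φ : Polynomial ℝ) : Prop where
  natDegree_le : Φ.natDegree ≤ c.maxDelay
  factor : c.spectralDensity =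
    algebraMap (Polynomial ℝ) (RatFunc ℝ) Φ * Polynomial.aeval (RatFunc.X⁻¹ : RatFunc ℝ) Φ
  minimumPhase : Φ ≠ 0 → ∀ ζ : ℂ, ‖ζ‖ < 1 → Polynomial.aeval ζ Φ ≠ 0

/-- The coefficient of frequency variation `W_i = H_i⁻¹ Φ_i`. -/
def freqVariation (Φ : Polynomial ℝ) : RatFunc ℝ :=
  c.nominal⁻¹ * algebraMap (Polynomial ℝ) (RatFunc ℝ) Φ

end Channel

section System

variable {m q : ℕ} (P : Matrix (Fin q) (Fin m) (RatFunc ℝ)) (K : Matrix (Fin m) (Fin q) (RatFunc ℝ))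
  (c : Fin m → Channel)

/-- `H = diag (H_1, …, H_m)`. -/
def nominalChannel : Matrix (Fin m) (Fin m) (RatFunc ℝ) :=
  Matrix.diagonal fun i => (c i).nominal

/-- `S = (I + P H K)⁻¹`. -/
def sensitivity : Matrix (Fin q) (Fin q) (RatFunc ℝ) := (1 + P * nominalChannel c * K)⁻¹

/-- The nominal feedback system `G = K (I + P H K)⁻¹ P`. -/
def nominalFeedback : Matrix (Fin m) (Fin m) (RatFunc ℝ) := K * sensitivity P K c * P

/-- The nominal complementary sensitivity `T = K (I + P H K)⁻¹ P H`. -/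
def complementarySensitivity : Matrix (Fin m) (Fin m) (RatFunc ℝ) :=
  K * sensitivity P K c * P * nominalChannel c

/-- Internal stability of the nominal loop of `P`, `K` and the (stable) nominal channel `H`: with
exogenous signals added at the input of `P` and at the input of `K`, the four transfer matrices to
the output and the input of `K` are in `RH∞`.  (The input of `P` is then a stable function of the
exogenous signals as well, since `H` is stable.) -/
structure NominalInternallyStable : Prop where
  KSP : ∀ i j, IsRHInf (nominalFeedback P K c i j)
  KS : ∀ i j, IsRHInf ((K * sensitivity P K c) i j)
  SP : ∀ i j, IsRHInf ((sensitivity P K c * P) i j)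
  S : ∀ i j, IsRHInf (sensitivity P K c i j)

/-- A sample path of the feedback loop `y = P (v - u_d)`, `u = K y`, `u_d = Δ u`, for the delays
`χ` and the exogenous input `v`; moreover `e = v - d` with `d = Ω u`. -/
structure IsLoopPath (χ : Fin m → ℕ → ℕ) (v e u : ℕ → Fin m → ℝ) (y : ℕ → Fin q → ℝ) : Prop where
  plant : ∀ k, y k =
    ltiOutput P (fun n i => v n i - (c i).output (χ i) (fun l => u l i) n) k
  controller : ∀ k, u k = ltiOutput K y k
  error : ∀ k i, e k i = v k i - (c i).uncertaintyOutput (χ i) (fun l => u l i) k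

variable {Ω : Type} [MeasurableSpace Ω]

/-- The transmission delays `χ i k` take values in `{0, …, maxDelay}`, have the prescribed
distribution, and are independent over all times `k` and all channels `i`. -/
structure IsDelayProcess (χ : Fin m → ℕ → Ω → ℕ) (μ : Measure Ω) : Prop where
  measurable : ∀ i k, Measurable (χ i k)
  le_maxDelay : ∀ i k ω, χ i k ω ≤ (c i).maxDelay
  law : ∀ i k, ∀ j ≤ (c i).maxDelay, μ {ω | χ i k ω = j} = ENNReal.ofReal ((c i).prob j)
  indep : iIndepFun (fun (s : Fin m × ℕ) => χ s.1 s.2) μ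

/-- `v` is an i.i.d. zero-mean process of random vectors with finite diagonal covariance. -/
structure IsWhiteNoise (v : ℕ → Ω → Fin m → ℝ) (μ : Measure Ω) : Prop where
  measurable : ∀ k, Measurable (v k)
  indep : iIndepFun v μ
  identDistrib : ∀ k, IdentDistrib (v k) (v 0) μ μ
  memLp : ∀ k i, MemLp (fun ω => v k ω i) 2 μ
  zero_mean : ∀ k i, ∫ ω, v k ω i ∂μ = 0
  uncorrelated : ∀ k i j, i ≠ j → ∫ ω, v k ω i * v k ω j ∂μ = 0

/-- The matrices `E{x(k) x(k)ᵀ}` exist and are bounded uniformly in `k`. -/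
def BoundedVariance (x : ℕ → Ω → Fin m → ℝ) (μ : Measure Ω) : Prop :=
  ∃ B : ℝ, ∀ k i j, Integrable (fun ω => x k ω i * x k ω j) μ ∧ |∫ ω, x k ω i * x k ω j ∂μ| ≤ B

/-- Mean-square internal stability: the nominal loop is internally stable, and for every white
noise input that is independent of the delays the variances of `e` and `u` are bounded. -/
def MeanSquareInternallyStable : Prop :=
  NominalInternallyStable P K c ∧
  ∀ (Ω : Type) [MeasurableSpace Ω] (μ : Measure Ω) [IsProbabilityMeasure μ]
    (χ : Fin m → ℕ → Ω → ℕ) (v e u : ℕ → Ω → Fin m → ℝ) (y : ℕ → Ω → Fin q → ℝ),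
    IsDelayProcess c χ μ → IsWhiteNoise v μ →
    IndepFun (fun ω k => v k ω) (fun ω i k => χ i k ω) μ →
    (∀ ω, IsLoopPath P K c (fun i k => χ i k ω) (fun k => v k ω) (fun k => e k ω)
      (fun k => u k ω) (fun k => y k ω)) →
    BoundedVariance e μ ∧ BoundedVariance u μ

/-- The matrix with entries `‖T_{ij} W_j‖₂²`. -/
def hatTW (Φ : Fin m → Polynomial ℝ) : Matrix (Fin m) (Fin m) ℝ :=
  Matrix.of fun i j =>
    h2NormSq (complementarySensitivity P K c i j * (c j).freqVariation (Φ j))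

end System

end RandomDelay

end

/-! Put `G = K(I+PHK)⁻¹P`. Splitting each channel into its mean `H` and the zero-mean part turns the
loop into `u = G e`, `e = v - d`, with `d` linear in `u`. Since `P` is strictly proper, `G` has no
feedthrough. Grouping the contributions to `d` by sending time gives a strictly causal recursion:
`u(k)` is the response of `G` to `v` minus a sum over `n < k` of `A(χ_n, k-n) u(n)`, where `A(x, s)`
is the response of `G`, after `s` steps, to the deviation pulse of a datum with delay `x`.

Now `A(χ_n, ·)` has mean zero and `u(n)` depends only on `v` and on delays before time `n`. Hence
all terms of the recursion are mutually orthogonal, and the second moments satisfy the exact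
Volterra equation `x_a(k) = f_a(k) + ∑_b ∑_{n<k} Γ_ab(k-n) x_b(n)` with `Γ_ab(s) = E A_ab(χ, s)² ≥
0`. By Parseval's identity, and because `|Φ|²` on the unit circle is the mean squared modulus of the
deviation transform, `∑_s Γ_ab(s) = ‖G_ab Φ_b‖₂² = ‖T_ab W_b‖₂²`. The matrix of total masses is
therefore `hatTW` (`IsRHInf.hasSum_momentKernel`).

What is left concerns nonnegative Volterra equations with mass matrix `M`. If `ρ(M) < 1`, a vector
`w` with `B + M w ≤ w` bounds the solution for all times (`volterra_bounded`); `d` is a finite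
combination of past `u`, so `e` is bounded too. Conversely, for unit Gaussian noise the solution is
nondecreasing in time. If it is bounded it has a limit `X` with `f(k) + M X ≤ X` for every `k`, so
`M X < X` in every row that is ever forced, and the other rows of `M` vanish. Comparing an
eigenvector with `X` gives `ρ(M) < 1` (`spectralRadius_lt_one_of_volterra_bounded`). -/

namespace RandomDelay

/-! ### Transfer functions and signals as formal power series in `z⁻¹`. -/

/-- The embedding of the rational functions into the Laurent series, as a ring homomorphism. -/
noncomputable def laurentHom : RatFunc ℝ →+* LaurentSeries ℝ where
  toFun f := (f : LaurentSeries ℝ)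
  map_one' := map_one _
  map_mul' := map_mul _
  map_zero' := map_zero _
  map_add' := map_add _

/-- The expansion of a transfer function at `z = ∞`, as a power series in `z⁻¹`. -/
noncomputable def transferSeries (f : RatFunc ℝ) : PowerSeries ℝ := PowerSeries.mk (impulseResponse f)

@[simp]
theorem coeff_transferSeries (f : RatFunc ℝ) (n : ℕ) :
    PowerSeries.coeff n (transferSeries f) = impulseResponse f n := by
  simp [transferSeries]

theorem transferSeries_eq_of_coe_eq {f : RatFunc ℝ} {p : PowerSeries ℝ}
    (h : (f : LaurentSeries ℝ) = HahnSeries.ofPowerSeries ℤ ℝ p) : transferSeries f = p := by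
  ext n
  rw [coeff_transferSeries, impulseResponse, h, LaurentSeries.coeff_coe_powerSeries]

theorem algebraMap_laurentSeries (p : Polynomial ℝ) :
    ((algebraMap (Polynomial ℝ) (RatFunc ℝ) p : RatFunc ℝ) : LaurentSeries ℝ) =
      HahnSeries.ofPowerSeries ℤ ℝ (p : PowerSeries ℝ) := by
  rw [RatFunc.coe_coe, RatFunc.coePolynomial_eq_algebraMap]

theorem transferSeries_algebraMap (p : Polynomial ℝ) :
    transferSeries (algebraMap (Polynomial ℝ) (RatFunc ℝ) p) = (p : PowerSeries ℝ) :=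
  transferSeries_eq_of_coe_eq (algebraMap_laurentSeries p)

/-- A denominator with nonzero constant term is invertible as a power series, so the Laurent
expansion has no principal part for `transferSeries` to discard. -/
theorem IsProper.coe_transferSeries {f : RatFunc ℝ} (hf : IsProper f) :
    HahnSeries.ofPowerSeries ℤ ℝ (transferSeries f) = (f : LaurentSeries ℝ) := by
  set D : PowerSeries ℝ := (f.denom : PowerSeries ℝ) with hD
  have hD0 : PowerSeries.constantCoeff D ≠ 0 := by
    rw [hD, ← PowerSeries.coeff_zero_eq_constantCoeff_apply, Polynomial.coeff_coe,
      Polynomial.coeff_zero_eq_eval_zero]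
    exact hf
  have key : (f : LaurentSeries ℝ) =
      HahnSeries.ofPowerSeries ℤ ℝ ((f.num : PowerSeries ℝ) * D⁻¹) := by
    have h1 : (f : LaurentSeries ℝ) * HahnSeries.ofPowerSeries ℤ ℝ D =
        HahnSeries.ofPowerSeries ℤ ℝ (f.num : PowerSeries ℝ) := by
      rw [hD, ← algebraMap_laurentSeries, ← algebraMap_laurentSeries, ← map_mul]
      congr 1
      have := RatFunc.num_div_denom f
      rw [div_eq_iff (RatFunc.algebraMap_ne_zero f.denom_ne_zero)] at this
      exact this.symm
    have h2 : HahnSeries.ofPowerSeries ℤ ℝ D * HahnSeries.ofPowerSeries ℤ ℝ D⁻¹ = 1 := by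
      rw [← map_mul, PowerSeries.mul_inv_cancel _ hD0, map_one]
    rw [map_mul, ← h1, mul_assoc, h2, mul_one]
  rw [transferSeries_eq_of_coe_eq key, key]

theorem IsProper.transferSeries_mul_denom {f : RatFunc ℝ} (hf : IsProper f) :
    transferSeries f * (f.denom : PowerSeries ℝ) = (f.num : PowerSeries ℝ) := by
  apply HahnSeries.ofPowerSeries_injective (Γ := ℤ)
  rw [map_mul, hf.coe_transferSeries, ← algebraMap_laurentSeries, ← algebraMap_laurentSeries,
    ← map_mul]
  congr 1
  have := RatFunc.num_div_denom f
  rw [div_eq_iff (RatFunc.algebraMap_ne_zero f.denom_ne_zero)] at this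
  exact this.symm

theorem IsStrictlyProper.impulseResponse_zero {f : RatFunc ℝ} (hf : IsStrictlyProper f) :
    impulseResponse f 0 = 0 := by
  have h := congrArg (PowerSeries.coeff 0) hf.1.transferSeries_mul_denom
  have h1 : impulseResponse f 0 * f.denom.eval 0 = f.num.eval 0 := by
    simpa [PowerSeries.coeff_mul, Polynomial.coeff_zero_eq_eval_zero] using h
  rw [hf.2] at h1
  exact (mul_eq_zero.1 h1).resolve_right hf.1

theorem IsRHInf.isProper {f : RatFunc ℝ} (hf : IsRHInf f) : IsProper f := by
  have h := hf 0 (by simp)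
  intro h0
  apply h
  rw [← Polynomial.coeff_zero_eq_aeval_zero', Polynomial.coeff_zero_eq_eval_zero, h0, map_zero]

/-! ### Signals as power series -/

/-- The generating series of the components of a signal. -/
noncomputable def signalSeries {b : ℕ} (x : ℕ → Fin b → ℝ) (j : Fin b) : PowerSeries ℝ :=
  PowerSeries.mk fun n => x n j

theorem coeff_mul_eq_sum_range (p : PowerSeries ℝ) (x : ℕ → ℝ) (k : ℕ) :
    PowerSeries.coeff k (p * PowerSeries.mk x) =
      ∑ n ∈ Finset.range (k + 1), PowerSeries.coeff (k - n) p * x n := by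
  rw [mul_comm, PowerSeries.coeff_mul,
    Finset.Nat.sum_antidiagonal_eq_sum_range_succ
      (fun i j => PowerSeries.coeff i (PowerSeries.mk x) * PowerSeries.coeff j p)]
  simp [mul_comm]

theorem signalSeries_ltiOutput {a b : ℕ} (F : Matrix (Fin a) (Fin b) (RatFunc ℝ))
    (x : ℕ → Fin b → ℝ) :
    signalSeries (ltiOutput F x) = (F.map transferSeries).mulVec (signalSeries x) := by
  ext i k
  simp only [signalSeries, PowerSeries.coeff_mk, ltiOutput, Matrix.mulVec, dotProduct,
    Matrix.map_apply, map_sum, coeff_mul_eq_sum_range, coeff_transferSeries]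
  exact Finset.sum_comm

/-- Because `transferSeries` drops principal parts, it respects products only when the entries are
proper. -/
theorem map_transferSeries_mul {a b d : ℕ} {F : Matrix (Fin a) (Fin b) (RatFunc ℝ)}
    {F' : Matrix (Fin b) (Fin d) (RatFunc ℝ)} (h : ∀ i j, IsProper (F i j))
    (h' : ∀ i j, IsProper (F' i j)) :
    (F * F').map transferSeries = F.map transferSeries * F'.map transferSeries := by
  ext1 i j
  apply transferSeries_eq_of_coe_eq
  simp only [Matrix.mul_apply, Matrix.map_apply, map_sum, map_mul, (h _ _).coe_transferSeries,
    (h' _ _).coe_transferSeries]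

/-- If the denominator vanished at `0`, so would the numerator `p * denom`, against coprimality.
This gives closure properties of properness without computing reduced fractions. -/
theorem isProper_of_coe_eq {f : RatFunc ℝ} {p : PowerSeries ℝ}
    (h : (f : LaurentSeries ℝ) = HahnSeries.ofPowerSeries ℤ ℝ p) : IsProper f := by
  intro h0
  have hmul : p * (f.denom : PowerSeries ℝ) = (f.num : PowerSeries ℝ) := by
    apply HahnSeries.ofPowerSeries_injective (Γ := ℤ)
    rw [map_mul, ← h, ← algebraMap_laurentSeries, ← algebraMap_laurentSeries, ← map_mul]
    congr 1
    have := RatFunc.num_div_denom f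
    rw [div_eq_iff (RatFunc.algebraMap_ne_zero f.denom_ne_zero)] at this
    exact this.symm
  have hn : f.num.eval 0 = 0 := by
    have h1 := congrArg (PowerSeries.coeff 0) hmul
    simpa [PowerSeries.coeff_mul, Polynomial.coeff_zero_eq_eval_zero, h0] using h1.symm
  obtain ⟨r, s, hrs⟩ := RatFunc.isCoprime_num_denom f
  have := congrArg (Polynomial.eval 0) hrs
  simp [h0, hn] at this

theorem IsProper.matrix_mul {a b d : ℕ} {F : Matrix (Fin a) (Fin b) (RatFunc ℝ)}
    {F' : Matrix (Fin b) (Fin d) (RatFunc ℝ)} (h : ∀ i j, IsProper (F i j))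
    (h' : ∀ i j, IsProper (F' i j)) (i : Fin a) (j : Fin d) : IsProper ((F * F') i j) := by
  apply isProper_of_coe_eq (p := (F.map transferSeries * F'.map transferSeries) i j)
  simp only [Matrix.mul_apply, Matrix.map_apply, map_sum, map_mul, (h _ _).coe_transferSeries,
    (h' _ _).coe_transferSeries]

/-! ### Splitting a channel into its mean and its deviation. -/

namespace Channel

variable (c : Channel)

/-- The polynomial in `z⁻¹` of the nominal channel. -/
noncomputable def nominalPoly : Polynomial ℝ :=
  ∑ j ∈ Finset.range (c.maxDelay + 1), Polynomial.C (c.mean j) * Polynomial.X ^ j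

theorem algebraMap_nominalPoly :
    algebraMap (Polynomial ℝ) (RatFunc ℝ) c.nominalPoly = c.nominal := by
  simp [nominalPoly, nominal, map_sum]

theorem isProper_nominal : IsProper c.nominal := by
  apply isProper_of_coe_eq (p := (c.nominalPoly : PowerSeries ℝ))
  rw [← algebraMap_nominalPoly, algebraMap_laurentSeries]

/-- The deviation from its mean of the response of the channel, `j` steps after a unit impulse
that is sent with delay `x`. -/
noncomputable def dev (x j : ℕ) : ℝ := if j ≤ c.maxDelay then c.resp x j - c.mean j else 0

/-- The substitution `n = k - j` passes from the age of a datum to its sending time. -/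
theorem sum_range_maxDelay (F : ℕ → ℕ → ℝ) (k : ℕ) :
    (∑ j ∈ Finset.range (c.maxDelay + 1), if j ≤ k then F j (k - j) else 0) =
      ∑ n ∈ Finset.range (k + 1), if k - n ≤ c.maxDelay then F (k - n) n else 0 := by
  rw [← Finset.sum_filter, ← Finset.sum_filter]
  refine Finset.sum_nbij' (fun j => k - j) (fun n => k - n) ?_ ?_ ?_ ?_ ?_
  · intro j hj
    simp only [Finset.mem_filter, Finset.mem_range] at hj ⊢
    omega
  · intro j hj
    simp only [Finset.mem_filter, Finset.mem_range] at hj ⊢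
    omega
  · intro j hj
    simp only [Finset.mem_filter, Finset.mem_range] at hj
    omega
  · intro j hj
    simp only [Finset.mem_filter, Finset.mem_range] at hj
    omega
  · intro j hj
    simp only [Finset.mem_filter, Finset.mem_range] at hj
    rw [Nat.sub_sub_self hj.2]

theorem uncertaintyOutput_eq (χ : ℕ → ℕ) (u : ℕ → ℝ) (k : ℕ) :
    c.uncertaintyOutput χ u k = ∑ n ∈ Finset.range (k + 1), c.dev (χ n) (k - n) * u n := by
  rw [uncertaintyOutput, c.sum_range_maxDelay (fun j n => (c.resp (χ n) j - c.mean j) * u n)]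
  refine Finset.sum_congr rfl fun n _ => ?_
  simp [dev, ite_mul]

theorem mk_output (χ : ℕ → ℕ) (u : ℕ → ℝ) :
    PowerSeries.mk (c.output χ u) = transferSeries c.nominal * PowerSeries.mk u +
      PowerSeries.mk (c.uncertaintyOutput χ u) := by
  ext k
  rw [map_add, coeff_mul_eq_sum_range, ← algebraMap_nominalPoly, transferSeries_algebraMap,
    PowerSeries.coeff_mk, PowerSeries.coeff_mk, output, uncertaintyOutput,
    c.sum_range_maxDelay (fun j n => (c.resp (χ n) j - c.mean j) * u n),
    c.sum_range_maxDelay (fun j n => c.resp (χ n) j * u n), ← Finset.sum_add_distrib]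
  refine Finset.sum_congr rfl fun n _ => ?_
  rw [Polynomial.coeff_coe, nominalPoly, Polynomial.finsetSum_coeff]
  simp only [Polynomial.coeff_C_mul_X_pow, Finset.sum_ite_eq, Finset.mem_range, Nat.lt_succ_iff]
  split_ifs <;> ring

end Channel

/-- The response, `s` steps later, of the system `f` to the deviation of the channel output from
its mean that is caused by a unit impulse sent with delay `x`. -/
noncomputable def pulseResponse (f : RatFunc ℝ) (c : Channel) (x s : ℕ) : ℝ :=
  PowerSeries.coeff s (transferSeries f * PowerSeries.mk (c.dev x))

/-- Exchanging the two convolutions groups everything by sending time, so each term carries exactly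
one random delay `χ n`. The orthogonality argument for second moments rests on this. -/
theorem coeff_mul_uncertaintyOutput (f : RatFunc ℝ) (c : Channel) (χ : ℕ → ℕ) (u : ℕ → ℝ) (k : ℕ) :
    PowerSeries.coeff k (transferSeries f * PowerSeries.mk (c.uncertaintyOutput χ u)) =
      ∑ n ∈ Finset.range (k + 1), pulseResponse f c (χ n) (k - n) * u n := by
  simp only [pulseResponse, coeff_mul_eq_sum_range, Channel.uncertaintyOutput_eq, Finset.mul_sum,
    Finset.sum_mul]
  rw [Finset.sum_comm' (t' := Finset.range (k + 1)) (s' := fun n => Finset.Ico n (k + 1))]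
  · refine Finset.sum_congr rfl fun n hn => ?_
    rw [Finset.sum_Ico_eq_sum_range]
    have hn' := Finset.mem_range.1 hn
    rw [show k + 1 - n = k - n + 1 by omega]
    refine Finset.sum_congr rfl fun s _ => ?_
    rw [show k - (n + s) = k - n - s by omega, show n + s - n = s by omega]
    ring
  · intro t n
    simp only [Finset.mem_range, Finset.mem_Ico]
    omega

/-! ### The closed loop over power series and its causal recursion. -/

section System

variable {m q : ℕ} {P : Matrix (Fin q) (Fin m) (RatFunc ℝ)} {K : Matrix (Fin m) (Fin q) (RatFunc ℝ)}
  {c : Fin m → Channel}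

theorem isProper_nominalChannel (i j : Fin m) : IsProper (nominalChannel c i j) := by
  rw [nominalChannel, Matrix.diagonal_apply]
  split_ifs
  · exact (c i).isProper_nominal
  · exact isProper_of_coe_eq (p := 0) (by simp)

/-- The nominal loop is well posed: `I + P H K` is the identity at `z = ∞`. -/
theorem isUnit_det_one_add (hP : ∀ i j, IsStrictlyProper (P i j)) (hK : ∀ i j, IsProper (K i j)) :
    IsUnit (1 + P * nominalChannel c * K).det := by
  have hPp : ∀ i j, IsProper (P i j) := fun i j => (hP i j).1
  have hPH := IsProper.matrix_mul hPp (isProper_nominalChannel (c := c))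
  have hL := IsProper.matrix_mul hPH hK
  set M : Matrix (Fin q) (Fin q) (PowerSeries ℝ) := (P * nominalChannel c * K).map transferSeries
    with hM
  have hM0 : M.map PowerSeries.constantCoeff = 0 := by
    have hP0 : (P.map transferSeries).map (PowerSeries.constantCoeff (R := ℝ)) = 0 := by
      ext i j
      simp only [Matrix.map_apply, Matrix.zero_apply]
      rw [← PowerSeries.coeff_zero_eq_constantCoeff_apply, coeff_transferSeries,
        (hP i j).impulseResponse_zero]
    rw [hM, map_transferSeries_mul hPH hK, map_transferSeries_mul hPp isProper_nominalChannel,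
      Matrix.map_mul, Matrix.map_mul, hP0, Matrix.zero_mul, Matrix.zero_mul]
  have hdet : PowerSeries.constantCoeff (1 + M).det = 1 := by
    rw [RingHom.map_det, map_add, map_one, RingHom.mapMatrix_apply, hM0, add_zero, Matrix.det_one]
  have hmap : laurentHom (1 + P * nominalChannel c * K).det =
      HahnSeries.ofPowerSeries ℤ ℝ (1 + M).det := by
    rw [RingHom.map_det, RingHom.map_det, map_add, map_add, map_one, map_one]
    congr 2
    ext1 i j
    simp only [RingHom.mapMatrix_apply, Matrix.map_apply, hM]
    exact ((hL i j).coe_transferSeries).symm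
  rw [isUnit_iff_ne_zero]
  intro h0
  rw [h0, map_zero] at hmap
  have : (1 + M).det = 0 := HahnSeries.ofPowerSeries_injective (Γ := ℤ) (by rw [← hmap, map_zero])
  rw [this, map_zero] at hdet
  exact zero_ne_one hdet

/-- `G = (K S) P` with `K S` proper and `P` zero at infinity. The missing feedthrough makes the
recursion for `u` strictly causal. -/
theorem NominalInternallyStable.impulseResponse_zero (h : NominalInternallyStable P K c)
    (hP : ∀ i j, IsStrictlyProper (P i j)) (i j : Fin m) :
    impulseResponse (nominalFeedback P K c i j) 0 = 0 := by
  have h1 := map_transferSeries_mul (fun i j => (h.KS i j).isProper) (fun i j => (hP i j).1)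
  have h2 := congrFun (congrFun h1 i) j
  rw [Matrix.map_apply] at h2
  rw [nominalFeedback, ← coeff_transferSeries, h2, Matrix.mul_apply]
  simp [PowerSeries.coeff_mul, (hP _ _).impulseResponse_zero]

/-- Over power series "at rest before time `0`" is built in, and the loop is the linear system `y =
P (e - H u)`, `u = K y`. Thus `(1 + P H K) y = P e`, which the sensitivity inverts. -/
theorem IsLoopPath.eq_nominalFeedback (h : NominalInternallyStable P K c)
    (hP : ∀ i j, IsStrictlyProper (P i j)) (hK : ∀ i j, IsProper (K i j))
    {χ : Fin m → ℕ → ℕ} {v e u : ℕ → Fin m → ℝ} {y : ℕ → Fin q → ℝ}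
    (hl : IsLoopPath P K c χ v e u y) :
    signalSeries u = ((nominalFeedback P K c).map transferSeries).mulVec (signalSeries e) := by
  have hPp : ∀ i j, IsProper (P i j) := fun i j => (hP i j).1
  have hHp := isProper_nominalChannel (c := c)
  have hPH := IsProper.matrix_mul hPp hHp
  have hL := IsProper.matrix_mul hPH hK
  have hSp : ∀ i j, IsProper (sensitivity P K c i j) := fun i j => (h.S i j).isProper
  have hKSp := fun i j => (h.KS i j).isProper
  set P' := P.map transferSeries
  set K' := K.map transferSeries
  set H' := (nominalChannel c).map transferSeries with hH'
  set S' := (sensitivity P K c).map transferSeries with hS'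
  have hinv : S' * (1 + P' * H' * K') = 1 := by
    have h1 : sensitivity P K c * (1 + P * nominalChannel c * K) = 1 :=
      Matrix.nonsing_inv_mul _ (isUnit_det_one_add hP hK)
    rw [mul_add, mul_one] at h1
    have h2 : S' + S' * (P' * H' * K') = 1 := by
      rw [← map_transferSeries_mul hPp hHp, ← map_transferSeries_mul hPH hK,
        ← map_transferSeries_mul hSp hL]
      ext1 i j
      apply HahnSeries.ofPowerSeries_injective (Γ := ℤ)
      have h3 := congrArg (laurentHom) (congrFun (congrFun h1 i) j)
      simp only [Matrix.add_apply, Matrix.map_apply, map_add, hS'] at h3 ⊢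
      rw [(hSp i j).coe_transferSeries, (IsProper.matrix_mul hSp hL i j).coe_transferSeries]
      refine h3.trans ?_
      simp only [Matrix.one_apply]
      split_ifs <;> simp
    rw [mul_add, mul_one, h2]
  have hG : (nominalFeedback P K c).map transferSeries = K' * S' * P' := by
    rw [nominalFeedback, map_transferSeries_mul hKSp hPp, map_transferSeries_mul hK hSp]
  have hy : signalSeries y = P'.mulVec (signalSeries e - H'.mulVec (signalSeries u)) := by
    have : y = ltiOutput P (fun n i => v n i - (c i).output (χ i) (fun l => u l i) n) :=
      funext hl.plant
    rw [this, signalSeries_ltiOutput]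
    congr 1
    ext1 i
    -- The channel output is `H u + d`, so the plant input `v - u_d` equals `e - H u`.
    have h1 := (c i).mk_output (χ i) (fun l => u l i)
    have h2 : H'.mulVec (signalSeries u) i = transferSeries (c i).nominal *
        PowerSeries.mk (fun l => u l i) := by
      rw [Matrix.mulVec, dotProduct, Finset.sum_eq_single i]
      · simp [hH', nominalChannel, signalSeries]
      · intro j _ hj
        have h0 : transferSeries 0 = 0 := transferSeries_eq_of_coe_eq (by simp)
        simp [hH', nominalChannel, hj.symm, h0]
      · simp
    rw [Pi.sub_apply, h2, ← sub_eq_of_eq_add h1]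
    ext k
    simp [signalSeries, hl.error k i]
  have hu : signalSeries u = K'.mulVec (signalSeries y) := by
    have : u = ltiOutput K y := funext hl.controller
    conv_lhs => rw [this]
    rw [signalSeries_ltiOutput]
  have hy' : (1 + P' * H' * K').mulVec (signalSeries y) = P'.mulVec (signalSeries e) := by
    rw [Matrix.add_mulVec, Matrix.one_mulVec, ← Matrix.mulVec_mulVec, ← hu, ← Matrix.mulVec_mulVec]
    conv_lhs => rw [hy]
    rw [← Matrix.mulVec_add, sub_add_cancel]
  rw [hG, ← Matrix.mulVec_mulVec, ← hy', Matrix.mulVec_mulVec, Matrix.mul_assoc, hinv, Matrix.mul_one, hu]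

/-- The closed loop as a strictly causal recursion for `u`, driven by `v`. -/
theorem IsLoopPath.control_eq (h : NominalInternallyStable P K c)
    (hP : ∀ i j, IsStrictlyProper (P i j)) (hK : ∀ i j, IsProper (K i j))
    {χ : Fin m → ℕ → ℕ} {v e u : ℕ → Fin m → ℝ} {y : ℕ → Fin q → ℝ}
    (hl : IsLoopPath P K c χ v e u y) (k : ℕ) (a : Fin m) :
    u k a = ∑ b, ∑ n ∈ Finset.range (k + 1),
        impulseResponse (nominalFeedback P K c a b) (k - n) * v n b -
      ∑ b, ∑ n ∈ Finset.range k,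
        pulseResponse (nominalFeedback P K c a b) (c b) (χ b n) (k - n) * u n b := by
  have h1 := congrArg (PowerSeries.coeff k) (congrFun (hl.eq_nominalFeedback h hP hK) a)
  rw [signalSeries, PowerSeries.coeff_mk] at h1
  rw [h1, Matrix.mulVec, dotProduct, map_sum, ← Finset.sum_sub_distrib]
  refine Finset.sum_congr rfl fun b _ => ?_
  have he : signalSeries e b = signalSeries v b -
      PowerSeries.mk ((c b).uncertaintyOutput (χ b) (fun l => u l b)) := by
    ext n
    simp [signalSeries, hl.error n b]
  rw [he, mul_sub, map_sub, Matrix.map_apply, coeff_mul_uncertaintyOutput, signalSeries,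
    coeff_mul_eq_sum_range]
  congr 1
  · simp
  -- The term `n = k` contains the value of `G` at infinity, which is zero.
  rw [Finset.sum_range_succ]
  simp [pulseResponse, PowerSeries.coeff_mul, h.impulseResponse_zero hP]

end System

/-! ### Power series with absolutely summable coefficients -/

/-- The coefficients of a power series are absolutely summable. -/
def AbsSummable (p : PowerSeries ℂ) : Prop := Summable fun n => ‖PowerSeries.coeff n p‖

/-- The sum of a power series at a point. -/
noncomputable def seriesSum (p : PowerSeries ℂ) (ζ : ℂ) : ℂ := ∑' n, PowerSeries.coeff n p * ζ ^ n

theorem AbsSummable.mul {p r : PowerSeries ℂ} (hp : AbsSummable p) (hr : AbsSummable r) :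
    AbsSummable (p * r) := by
  have := summable_norm_sum_mul_antidiagonal_of_summable_norm hp hr
  simpa only [AbsSummable, PowerSeries.coeff_mul] using this

theorem AbsSummable.norm_mul_pow {p : PowerSeries ℂ} (hp : AbsSummable p) {ζ : ℂ} (hζ : ‖ζ‖ ≤ 1) :
    Summable fun n => ‖PowerSeries.coeff n p * ζ ^ n‖ := by
  refine Summable.of_nonneg_of_le (fun _ => norm_nonneg _) (fun n => ?_) hp
  rw [norm_mul, norm_pow]
  exact mul_le_of_le_one_right (norm_nonneg _) (pow_le_one₀ (norm_nonneg _) hζ)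

theorem seriesSum_mul {p r : PowerSeries ℂ} (hp : AbsSummable p) (hr : AbsSummable r) {ζ : ℂ}
    (hζ : ‖ζ‖ ≤ 1) : seriesSum (p * r) ζ = seriesSum p ζ * seriesSum r ζ := by
  rw [seriesSum, seriesSum, seriesSum, tsum_mul_tsum_eq_tsum_sum_antidiagonal_of_summable_norm
    (hp.norm_mul_pow hζ) (hr.norm_mul_pow hζ)]
  refine tsum_congr fun n => ?_
  rw [PowerSeries.coeff_mul, Finset.sum_mul]
  refine Finset.sum_congr rfl fun x hx => ?_
  rw [← Finset.HasAntidiagonal.mem_antidiagonal.1 hx, pow_add]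
  ring

theorem absSummable_of_eq_zero {p : PowerSeries ℂ} (N : ℕ)
    (h : ∀ n, N < n → PowerSeries.coeff n p = 0) : AbsSummable p := by
  refine summable_of_ne_finset_zero (s := Finset.range (N + 1)) fun n hn => ?_
  rw [h n (by simpa using hn), norm_zero]

theorem seriesSum_of_eq_zero {p : PowerSeries ℂ} (N : ℕ)
    (h : ∀ n, N < n → PowerSeries.coeff n p = 0) (ζ : ℂ) :
    seriesSum p ζ = ∑ n ∈ Finset.range (N + 1), PowerSeries.coeff n p * ζ ^ n :=
  tsum_eq_sum fun n hn => by rw [h n (by simpa using hn), zero_mul]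

theorem absSummable_polynomial (p : Polynomial ℂ) : AbsSummable (p : PowerSeries ℂ) :=
  absSummable_of_eq_zero p.natDegree fun n hn => by
    rw [Polynomial.coeff_coe, Polynomial.coeff_eq_zero_of_natDegree_lt hn]

theorem seriesSum_polynomial (p : Polynomial ℂ) (ζ : ℂ) :
    seriesSum (p : PowerSeries ℂ) ζ = p.eval ζ := by
  rw [seriesSum_of_eq_zero p.natDegree, Polynomial.eval_eq_sum_range]
  · simp
  · intro n hn
    rw [Polynomial.coeff_coe, Polynomial.coeff_eq_zero_of_natDegree_lt hn]

/-- The inverse of `X - a` is the series of `-a⁻¹ ^ (n + 1)`, geometric with ratio of modulus less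
than one. -/
theorem exists_absSummable_inv_X_sub_C {a : ℂ} (ha : 1 < ‖a‖) :
    ∃ E, AbsSummable E ∧ ((Polynomial.X - Polynomial.C a : Polynomial ℂ) : PowerSeries ℂ) * E = 1 := by
  have ha0 : a ≠ 0 := by
    rintro rfl
    simp at ha
    linarith
  refine ⟨PowerSeries.mk fun n => -(a⁻¹) ^ (n + 1), ?_, ?_⟩
  · have hg : Summable fun n : ℕ => ‖a‖⁻¹ ^ n :=
      summable_geometric_of_lt_one (by positivity) (inv_lt_one_of_one_lt₀ ha)
    refine ((summable_nat_add_iff 1).2 hg).congr fun n => ?_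
    simp
  · ext n
    rw [Polynomial.coe_sub, Polynomial.coe_X, Polynomial.coe_C, sub_mul, map_sub,
      PowerSeries.coeff_C_mul]
    cases n with
    | zero => simp [ha0]
    | succ n =>
      rw [PowerSeries.coeff_succ_X_mul]
      simp only [PowerSeries.coeff_mk, PowerSeries.coeff_one]
      rw [if_neg (Nat.succ_ne_zero n), pow_succ (a⁻¹) (n + 1)]
      field_simp
      ring

theorem exists_absSummable_inv_prod (s : Multiset ℂ) (hs : ∀ a ∈ s, 1 < ‖a‖) :
    ∃ E, AbsSummable E ∧
      (((s.map fun a => Polynomial.X - Polynomial.C a).prod : Polynomial ℂ) : PowerSeries ℂ) * E = 1 := by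
  induction s using Multiset.induction_on with
  | empty => exact ⟨1, by simpa using absSummable_polynomial 1, by simp⟩
  | cons a s ih =>
    obtain ⟨E, hE, hE1⟩ := ih fun b hb => hs b (Multiset.mem_cons_of_mem hb)
    obtain ⟨E', hE', hE1'⟩ := exists_absSummable_inv_X_sub_C (hs a (Multiset.mem_cons_self a s))
    refine ⟨E' * E, hE'.mul hE, ?_⟩
    rw [Multiset.map_cons, Multiset.prod_cons, Polynomial.coe_mul, mul_mul_mul_comm, hE1, hE1',
      one_mul]

/-- **Wiener's lemma** for polynomials: a polynomial without zeros in the closed unit disc has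
an inverse with absolutely summable coefficients. -/
theorem exists_absSummable_inv {D : Polynomial ℂ} (hD : ∀ ζ : ℂ, ‖ζ‖ ≤ 1 → D.eval ζ ≠ 0) :
    ∃ E, AbsSummable E ∧ (D : PowerSeries ℂ) * E = 1 := by
  have hD0 : D ≠ 0 := by
    rintro rfl
    exact hD 0 (by simp) (by simp)
  -- All roots lie outside the closed disc, so the linear factors over `ℂ` can be inverted one by
  -- one.
  obtain ⟨E, hE, hE1⟩ := exists_absSummable_inv_prod D.roots fun a ha => by
    by_contra hle
    exact hD a (not_lt.1 hle) (Polynomial.isRoot_of_mem_roots ha)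
  have hl : D.leadingCoeff ≠ 0 := Polynomial.leadingCoeff_ne_zero.2 hD0
  refine ⟨(Polynomial.C D.leadingCoeff⁻¹ : Polynomial ℂ) * E,
    (absSummable_polynomial _).mul hE, ?_⟩
  have hD' := congrArg (fun p : Polynomial ℂ => (p : PowerSeries ℂ)) (IsAlgClosed.splits D).eq_prod_roots
  simp only [Polynomial.coe_mul] at hD'
  rw [hD', mul_mul_mul_comm, hE1, mul_one, ← Polynomial.coe_mul, ← Polynomial.C_mul,
    mul_inv_cancel₀ hl]
  simp

/-- The complex power series of a transfer function. -/
noncomputable def complexSeries (p : PowerSeries ℝ) : PowerSeries ℂ :=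
  PowerSeries.map (algebraMap ℝ ℂ) p

theorem complexSeries_polynomial (p : Polynomial ℝ) :
    complexSeries (p : PowerSeries ℝ) = (p.map (algebraMap ℝ ℂ) : PowerSeries ℂ) := by
  ext n
  simp [complexSeries]

theorem IsRHInf.complexSeries_mul_denom {f : RatFunc ℝ} (hf : IsRHInf f) :
    complexSeries (transferSeries f) * (f.denom.map (algebraMap ℝ ℂ) : PowerSeries ℂ) =
      (f.num.map (algebraMap ℝ ℂ) : PowerSeries ℂ) := by
  rw [← complexSeries_polynomial, ← complexSeries_polynomial, complexSeries, complexSeries,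
    ← map_mul, hf.isProper.transferSeries_mul_denom]
  rfl

theorem IsRHInf.absSummable {f : RatFunc ℝ} (hf : IsRHInf f) :
    AbsSummable (complexSeries (transferSeries f)) := by
  obtain ⟨E, hE, hE1⟩ := exists_absSummable_inv (D := f.denom.map (algebraMap ℝ ℂ))
    fun ζ hζ => by
      rw [Polynomial.eval_map_algebraMap]
      exact hf ζ hζ
  have h := congrArg (· * E) hf.complexSeries_mul_denom
  simp only [mul_assoc, hE1, mul_one] at h
  rw [h]
  exact (absSummable_polynomial _).mul hE

/-- Both sides agree after multiplication by the denominator, which has no zero in the closed disc.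
This links the pointwise values in `h2NormSq` to the impulse response. -/
theorem IsRHInf.seriesSum_eq {f : RatFunc ℝ} (hf : IsRHInf f) {ζ : ℂ} (hζ : ‖ζ‖ ≤ 1) :
    seriesSum (complexSeries (transferSeries f)) ζ = f.eval (algebraMap ℝ ℂ) ζ := by
  have h := congrArg (seriesSum · ζ) hf.complexSeries_mul_denom
  simp only [seriesSum_mul hf.absSummable (absSummable_polynomial _) hζ, seriesSum_polynomial,
    Polynomial.eval_map] at h
  rw [RatFunc.eval, eq_div_iff, h]
  exact hf ζ hζ

/-! ### Parseval's identity -/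

theorem norm_exp_neg_mul_I (θ : ℝ) : ‖Complex.exp (-(θ * Complex.I))‖ = 1 := by
  rw [← neg_mul, ← Complex.ofReal_neg, Complex.norm_exp_ofReal_mul_I]

theorem AbsSummable.continuous_seriesSum {p : PowerSeries ℂ} (hp : AbsSummable p) :
    Continuous fun θ : ℝ => seriesSum p (Complex.exp (-(θ * Complex.I))) := by
  refine continuous_tsum (fun n => by fun_prop) hp fun n θ => ?_
  rw [norm_mul, norm_pow, norm_exp_neg_mul_I, one_pow, mul_one]

theorem integral_exp_pow_mul_conj (n l : ℕ) :
    ∫ θ in (-Real.pi)..Real.pi, Complex.exp (-((θ : ℝ) * Complex.I)) ^ n *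
      (starRingEnd ℂ) (Complex.exp (-((θ : ℝ) * Complex.I)) ^ l) =
      if n = l then 2 * (Real.pi : ℂ) else 0 := by
  have h : ∀ θ : ℝ, Complex.exp (-((θ : ℝ) * Complex.I)) ^ n *
      (starRingEnd ℂ) (Complex.exp (-((θ : ℝ) * Complex.I)) ^ l) =
      Complex.exp ((((l : ℂ) - n) * Complex.I) * θ) := by
    intro θ
    rw [map_pow, ← Complex.exp_conj, ← Complex.exp_nat_mul, ← Complex.exp_nat_mul, ← Complex.exp_add]
    congr 1
    simp
    ring
  simp only [h]
  split_ifs with hnl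
  · subst hnl
    simp
    ring
  · have hc : ((l : ℂ) - n) * Complex.I ≠ 0 := by
      refine mul_ne_zero (sub_ne_zero.2 ?_) Complex.I_ne_zero
      exact_mod_cast Ne.symm hnl
    rw [integral_exp_mul_complex hc, div_eq_zero_iff]
    left
    rw [sub_eq_zero]
    have := Complex.exp_int_mul_two_pi_mul_I ((l : ℤ) - n)
    rw [show ((l : ℂ) - n) * Complex.I * (Real.pi : ℝ) =
      ((l : ℂ) - n) * Complex.I * ((-Real.pi : ℝ) : ℂ) + (((l : ℤ) - n : ℤ) : ℂ) *
        (2 * Real.pi * Complex.I) by push_cast; ring, Complex.exp_add, this, mul_one]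

/-- On the circle `|p|² = p · conj p` is a double series dominated by the constants `|p_n| |p_l|`.
It may be integrated termwise, and orthogonality of the exponentials leaves the diagonal. -/
theorem AbsSummable.hasSum_norm_sq {p : PowerSeries ℂ} (hp : AbsSummable p) :
    HasSum (fun n => ‖PowerSeries.coeff n p‖ ^ 2)
      ((2 * Real.pi)⁻¹ * ∫ θ in (-Real.pi)..Real.pi,
        ‖seriesSum p (Complex.exp (-(θ * Complex.I)))‖ ^ 2) := by
  set E : ℝ → ℂ := fun θ => Complex.exp (-(θ * Complex.I)) with hE
  have hEn : ∀ θ, ‖E θ‖ = 1 := norm_exp_neg_mul_I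
  have hEc : Continuous E := by fun_prop
  set F : ℕ × ℕ → C(ℝ, ℂ) := fun x =>
    ⟨fun θ => (PowerSeries.coeff x.1 p * E θ ^ x.1) *
      (starRingEnd ℂ) (PowerSeries.coeff x.2 p * E θ ^ x.2), by fun_prop⟩ with hF
  have hnorm : ∀ n θ, ‖PowerSeries.coeff n p * E θ ^ n‖ = ‖PowerSeries.coeff n p‖ := fun n θ => by
    rw [norm_mul, norm_pow, hEn, one_pow, mul_one]
  have hs : Summable fun x : ℕ × ℕ => ‖PowerSeries.coeff x.1 p‖ * ‖PowerSeries.coeff x.2 p‖ :=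
    Summable.mul_of_nonneg hp hp (fun _ => norm_nonneg _) (fun _ => norm_nonneg _)
  have h1 := intervalIntegral.hasSum_integral_of_dominated_convergence (μ := volume)
    (a := -Real.pi) (b := Real.pi)
    (F := fun x θ => F x θ) (f := fun θ => ((‖seriesSum p (E θ)‖ ^ 2 : ℝ) : ℂ))
    (fun x _ => ‖PowerSeries.coeff x.1 p‖ * ‖PowerSeries.coeff x.2 p‖)
    (fun x => (F x).continuous.aestronglyMeasurable)
    (fun x => Filter.Eventually.of_forall fun θ _ => by
      simp only [hF, ContinuousMap.coe_mk, norm_mul, RCLike.norm_conj]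
      rw [← norm_mul, ← norm_mul, hnorm, hnorm])
    (Filter.Eventually.of_forall fun θ _ => hs) (by simp)
    (Filter.Eventually.of_forall fun θ _ => by
      have hq := hp.norm_mul_pow (hEn θ).le
      have hq' : Summable fun n => ‖(starRingEnd ℂ) (PowerSeries.coeff n p * E θ ^ n)‖ := by
        simpa only [RCLike.norm_conj] using hq
      have h2 := (summable_mul_of_summable_norm hq hq').hasSum
      rw [← tsum_mul_tsum_of_summable_norm hq hq', ← Complex.conj_tsum] at h2
      change HasSum _ (seriesSum p (E θ) * (starRingEnd ℂ) (seriesSum p (E θ))) at h2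
      rw [Complex.mul_conj'] at h2
      exact_mod_cast h2)
  have h2 : ∀ x : ℕ × ℕ, ∫ θ in (-Real.pi)..Real.pi, F x θ =
      if x.1 = x.2 then ((2 * Real.pi * ‖PowerSeries.coeff x.1 p‖ ^ 2 : ℝ) : ℂ) else 0 := by
    intro x
    have h3 : ∀ θ : ℝ, F x θ = (PowerSeries.coeff x.1 p * (starRingEnd ℂ) (PowerSeries.coeff x.2 p)) *
        (E θ ^ x.1 * (starRingEnd ℂ) (E θ ^ x.2)) := by
      intro θ
      simp only [hF, ContinuousMap.coe_mk, map_mul]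
      ring
    simp only [h3]
    rw [intervalIntegral.integral_const_mul, integral_exp_pow_mul_conj]
    split_ifs with hx
    · rw [← hx, Complex.mul_conj']
      push_cast
      ring
    · simp
  simp only [h2] at h1
  -- The sum over pairs is supported on the diagonal `n ↦ (n, n)`.
  have hinj : Function.Injective fun n : ℕ => (n, n) := fun a b h => (Prod.mk.inj h).1
  rw [← hinj.hasSum_iff, intervalIntegral.integral_ofReal] at h1
  · simp only [Function.comp_def, if_true] at h1
    have h4 := (Complex.hasSum_ofReal.1 h1).mul_left (2 * Real.pi)⁻¹
    refine h4.congr_fun fun n => ?_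
    rw [inv_mul_cancel_left₀ (by positivity)]
  · rintro ⟨a, b⟩ hab
    exact if_neg fun h : a = b => hab ⟨a, by rw [h]⟩

/-! ### The spectral factor on the unit circle -/

namespace Channel

variable (c : Channel)

/-- The transform of the deviation from the mean of the response to an impulse of delay `x`. -/
noncomputable def devTransform (x : ℕ) (ζ : ℂ) : ℂ :=
  ∑ j ∈ Finset.range (c.maxDelay + 1), (c.dev x j : ℂ) * ζ ^ j

theorem cov_comm (j l : ℕ) : c.cov j l = c.cov l j := by
  simp only [cov, mul_comm (c.resp _ j - c.mean j)]

theorem cov_eq_sum_dev {j l : ℕ} (hj : j ≤ c.maxDelay) (hl : l ≤ c.maxDelay) :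
    c.cov j l = ∑ x ∈ Finset.range (c.maxDelay + 1), c.prob x * (c.dev x j * c.dev x l) := by
  simp [cov, dev, hj, hl]

/-- The pairs `(j, l)` are grouped by their difference. Symmetry of the covariance lets `autoCov`
serve lags of both signs. -/
theorem sum_cov_mul_zpow (ζ : ℂ) :
    ∑ l ∈ Finset.Icc (-(c.maxDelay : ℤ)) c.maxDelay, (c.autoCov l.natAbs : ℂ) * ζ ^ l =
      ∑ j ∈ Finset.range (c.maxDelay + 1), ∑ l ∈ Finset.range (c.maxDelay + 1),
        (c.cov j l : ℂ) * ζ ^ ((j : ℤ) - l) := by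
  rw [← Finset.sum_product', ← Finset.sum_fiberwise_of_maps_to
    (t := Finset.Icc (-(c.maxDelay : ℤ)) c.maxDelay) (g := fun x : ℕ × ℕ => (x.1 : ℤ) - x.2)]
  · refine Finset.sum_congr rfl fun l hl => ?_
    rw [Finset.mem_Icc] at hl
    rw [autoCov, Complex.ofReal_sum, Finset.sum_mul]
    rcases le_or_gt 0 l with h0 | h0
    · lift l to ℕ using h0
      refine Finset.sum_nbij' (fun j => (j + l, j)) (fun x => x.2) ?_ ?_ ?_ ?_ ?_
      · intro j hj
        simp only [Finset.mem_range, Finset.mem_filter, Finset.mem_product, Int.natAbs_natCast] at hj ⊢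
        omega
      · intro x hx
        simp only [Finset.mem_range, Finset.mem_filter, Finset.mem_product, Int.natAbs_natCast] at hx ⊢
        omega
      · intro j _
        rfl
      · rintro ⟨a, b⟩ hx
        simp only [Finset.mem_range, Finset.mem_filter, Finset.mem_product] at hx
        ext1 <;> simp only
        omega
      · intro j _
        rw [Int.natAbs_natCast, c.cov_comm]
        congr 2
        push_cast
        ring
    · obtain ⟨n, rfl⟩ : ∃ n : ℕ, l = -n := ⟨l.natAbs, by omega⟩
      refine Finset.sum_nbij' (fun j => (j, j + n)) (fun x => x.1) ?_ ?_ ?_ ?_ ?_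
      · intro j hj
        simp only [Finset.mem_range, Finset.mem_filter, Finset.mem_product, Int.natAbs_neg,
          Int.natAbs_natCast] at hj ⊢
        omega
      · intro x hx
        simp only [Finset.mem_range, Finset.mem_filter, Finset.mem_product, Int.natAbs_neg,
          Int.natAbs_natCast] at hx ⊢
        omega
      · intro j _
        rfl
      · rintro ⟨a, b⟩ hx
        simp only [Finset.mem_range, Finset.mem_filter, Finset.mem_product] at hx
        ext1 <;> simp only
        omega
      · intro j _
        rw [Int.natAbs_neg, Int.natAbs_natCast]
        congr 2
        push_cast
        ring
  · intro x hx
    simp only [Finset.mem_range, Finset.mem_product, Finset.mem_Icc] at hx ⊢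
    omega

/-- On the circle `conj ζ = ζ⁻¹`, so expanding the squared modulus and averaging over the delay
yields the covariances: the density is the mean energy of the deviation pulse. -/
theorem sum_prob_norm_devTransform {ζ : ℂ} (hζ : ‖ζ‖ = 1) :
    ((∑ x ∈ Finset.range (c.maxDelay + 1), c.prob x * ‖c.devTransform x ζ‖ ^ 2 : ℝ) : ℂ) =
      ∑ l ∈ Finset.Icc (-(c.maxDelay : ℤ)) c.maxDelay, (c.autoCov l.natAbs : ℂ) * ζ ^ l := by
  have hζ0 : ζ ≠ 0 := by
    rintro rfl
    simp at hζ
  have hconj : (starRingEnd ℂ) ζ = ζ⁻¹ := by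
    rw [Complex.inv_def, Complex.normSq_eq_norm_sq, hζ]
    simp
  rw [sum_cov_mul_zpow]
  push_cast
  have h1 : ∀ x, (‖c.devTransform x ζ‖ : ℂ) ^ 2 =
      ∑ j ∈ Finset.range (c.maxDelay + 1), ∑ l ∈ Finset.range (c.maxDelay + 1),
        ((c.dev x j * c.dev x l : ℝ) : ℂ) * ζ ^ ((j : ℤ) - l) := by
    intro x
    rw [← Complex.mul_conj', devTransform, map_sum, Finset.sum_mul_sum]
    refine Finset.sum_congr rfl fun j _ => Finset.sum_congr rfl fun l _ => ?_
    rw [map_mul, map_pow, hconj, Complex.conj_ofReal, zpow_sub₀ hζ0, zpow_natCast, zpow_natCast,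
      inv_pow]
    push_cast
    field_simp
  simp only [h1, Finset.mul_sum]
  rw [Finset.sum_comm]
  refine Finset.sum_congr rfl fun j hj => ?_
  rw [Finset.sum_comm]
  refine Finset.sum_congr rfl fun l hl => ?_
  rw [c.cov_eq_sum_dev (Nat.lt_succ_iff.1 (Finset.mem_range.1 hj))
    (Nat.lt_succ_iff.1 (Finset.mem_range.1 hl))]
  push_cast
  rw [Finset.sum_mul]
  refine Finset.sum_congr rfl fun x _ => ?_
  ring

/-- The factor `z ^ N` clears negative powers. A general field allows use both at `RatFunc.X` and at
a point of the circle, which carries the spectral factorization from rational functions to complex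
values. -/
theorem aeval_sum_zpow_add {L : Type*} [Field L] [Algebra ℝ L] (r : ℕ → ℝ) (N : ℕ) {z : L}
    (hz : z ≠ 0) :
    Polynomial.aeval z (∑ l ∈ Finset.Icc (-(N : ℤ)) N,
      Polynomial.C (r l.natAbs) * Polynomial.X ^ (l + N).toNat) =
      z ^ N * ∑ l ∈ Finset.Icc (-(N : ℤ)) N, algebraMap ℝ L (r l.natAbs) * z ^ l := by
  rw [map_sum, Finset.mul_sum]
  refine Finset.sum_congr rfl fun l hl => ?_
  rw [Finset.mem_Icc] at hl
  rw [map_mul, map_pow, Polynomial.aeval_C, Polynomial.aeval_X, mul_left_comm, ← zpow_natCast z N,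
    ← zpow_add₀ hz, ← zpow_natCast z, Int.toNat_of_nonneg (by omega), add_comm l]

theorem aeval_sum_pow_sub {L : Type*} [Field L] [Algebra ℝ L] {Φ : Polynomial ℝ} {N : ℕ}
    (hΦ : Φ.natDegree ≤ N) {z : L} (hz : z ≠ 0) :
    Polynomial.aeval z (∑ j ∈ Finset.range (N + 1),
      Polynomial.C (Φ.coeff j) * Polynomial.X ^ (N - j)) = z ^ N * Polynomial.aeval z⁻¹ Φ := by
  rw [map_sum, Polynomial.aeval_eq_sum_range' (Nat.lt_succ_of_le hΦ), Finset.mul_sum]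
  refine Finset.sum_congr rfl fun j hj => ?_
  have hj' := Finset.mem_range.1 hj
  rw [map_mul, map_pow, Polynomial.aeval_C, Polynomial.aeval_X, Algebra.smul_def, mul_left_comm,
    inv_pow, pow_sub₀ z hz (by omega)]

/-- Cleared of denominators, the factorization is a polynomial identity and can be evaluated at `ζ`.
Since `Φ` is real, `Φ(ζ⁻¹)` is the conjugate of `Φ(ζ)` there. -/
theorem IsSpectralFactor.norm_sq {c : Channel} {Φ : Polynomial ℝ} (h : c.IsSpectralFactor Φ) {ζ : ℂ}
    (hζ : ‖ζ‖ = 1) :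
    ‖Polynomial.aeval ζ Φ‖ ^ 2 =
      ∑ x ∈ Finset.range (c.maxDelay + 1), c.prob x * ‖c.devTransform x ζ‖ ^ 2 := by
  have hζ0 : ζ ≠ 0 := by
    rintro rfl
    simp at hζ
  have hconj : (starRingEnd ℂ) ζ = ζ⁻¹ := by
    rw [Complex.inv_def, Complex.normSq_eq_norm_sq, hζ]
    simp
  set Q : Polynomial ℝ := ∑ l ∈ Finset.Icc (-(c.maxDelay : ℤ)) c.maxDelay,
    Polynomial.C (c.autoCov l.natAbs) * Polynomial.X ^ (l + c.maxDelay).toNat with hQ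
  set R : Polynomial ℝ := ∑ j ∈ Finset.range (c.maxDelay + 1),
    Polynomial.C (Φ.coeff j) * Polynomial.X ^ (c.maxDelay - j) with hR
  have hQR : Q = Φ * R := by
    apply RatFunc.algebraMap_injective ℝ
    rw [map_mul, ← RatFunc.aeval_X_left_eq_algebraMap Q, ← RatFunc.aeval_X_left_eq_algebraMap R,
      hQ, hR, aeval_sum_zpow_add _ _ RatFunc.X_ne_zero,
      aeval_sum_pow_sub h.natDegree_le RatFunc.X_ne_zero, mul_left_comm, ← h.factor]
    rfl
  have h1 := congrArg (Polynomial.aeval ζ) hQR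
  rw [map_mul, hQ, hR, aeval_sum_zpow_add _ _ hζ0, aeval_sum_pow_sub h.natDegree_le hζ0,
    mul_left_comm] at h1
  have h2 := mul_left_cancel₀ (pow_ne_zero _ hζ0) h1
  have h3 : (Polynomial.aeval ζ⁻¹ Φ : ℂ) = (starRingEnd ℂ) (Polynomial.aeval ζ Φ) := by
    rw [← hconj, ← Polynomial.aeval_conj]
  rw [h3, Complex.mul_conj'] at h2
  have h4 := c.sum_prob_norm_devTransform hζ
  have h5 := h4.trans h2
  exact_mod_cast h5.symm

theorem absSummable_dev (x : ℕ) : AbsSummable (complexSeries (PowerSeries.mk (c.dev x))) :=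
  absSummable_of_eq_zero c.maxDelay fun n hn => by simp [complexSeries, dev, not_le.2 hn]

theorem seriesSum_dev (x : ℕ) (ζ : ℂ) :
    seriesSum (complexSeries (PowerSeries.mk (c.dev x))) ζ = c.devTransform x ζ := by
  rw [seriesSum_of_eq_zero c.maxDelay fun n hn => by simp [complexSeries, dev, not_le.2 hn]]
  simp [devTransform, complexSeries]

end Channel

/-! ### The second-moment kernel and its total mass. -/

/-- The kernel of the recursion for the second moments: the mean square of the response `s` steps
after a unit impulse with random delay. -/
noncomputable def momentKernel (f : RatFunc ℝ) (c : Channel) (s : ℕ) : ℝ :=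
  ∑ x ∈ Finset.range (c.maxDelay + 1), c.prob x * pulseResponse f c x s ^ 2

theorem momentKernel_nonneg (f : RatFunc ℝ) (c : Channel) (s : ℕ) : 0 ≤ momentKernel f c s :=
  Finset.sum_nonneg fun x hx => mul_nonneg
    (c.prob_nonneg x (Nat.lt_succ_iff.1 (Finset.mem_range.1 hx))) (sq_nonneg _)

/-- Parseval is applied to the pulse response for each fixed delay. Averaging over the delay
replaces the squared deviation transforms by `|Φ|²` under the integral. -/
theorem IsRHInf.hasSum_momentKernel {f : RatFunc ℝ} (hf : IsRHInf f) {c : Channel}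
    {Φ : Polynomial ℝ} (h : c.IsSpectralFactor Φ) :
    HasSum (momentKernel f c)
      (h2NormSq (f * algebraMap (Polynomial ℝ) (RatFunc ℝ) Φ)) := by
  set p : ℕ → PowerSeries ℂ := fun x => complexSeries (transferSeries f) *
    complexSeries (PowerSeries.mk (c.dev x)) with hp
  have hpa : ∀ x, AbsSummable (p x) := fun x => hf.absSummable.mul (c.absSummable_dev x)
  have hcoeff : ∀ x s, ‖PowerSeries.coeff s (p x)‖ ^ 2 = pulseResponse f c x s ^ 2 := by
    intro x s
    simp only [hp, complexSeries]
    rw [← map_mul, PowerSeries.coeff_map, pulseResponse]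
    simp
  have h1 : HasSum (momentKernel f c) (∑ x ∈ Finset.range (c.maxDelay + 1), c.prob x *
      ((2 * Real.pi)⁻¹ * ∫ θ in (-Real.pi)..Real.pi,
        ‖seriesSum (p x) (Complex.exp (-(θ * Complex.I)))‖ ^ 2)) := by
    refine hasSum_sum fun x _ => HasSum.mul_left _ ?_
    simpa only [hcoeff] using (hpa x).hasSum_norm_sq
  convert h1 using 1
  rw [h2NormSq]
  simp only [mul_left_comm _ (2 * Real.pi)⁻¹]
  rw [← Finset.mul_sum]
  congr 1
  simp only [← intervalIntegral.integral_const_mul]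
  rw [← intervalIntegral.integral_finsetSum]
  · refine intervalIntegral.integral_congr fun θ _ => ?_
    have hθ := norm_exp_neg_mul_I θ
    rw [RatFunc.eval_mul, ← hf.seriesSum_eq hθ.le, RatFunc.eval_algebraMap, norm_mul, mul_pow]
    · have h2 := h.norm_sq hθ
      rw [Polynomial.aeval_def] at h2
      rw [Algebra.algebraMap_self_apply, h2, Finset.mul_sum]
      refine Finset.sum_congr rfl fun x _ => ?_
      rw [hp, seriesSum_mul hf.absSummable (c.absSummable_dev x) hθ.le, c.seriesSum_dev, norm_mul]
      ring
    · exact hf _ hθ.le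
    · rw [RatFunc.denom_algebraMap]
      simp
  · intro x _
    exact ((hpa x).continuous_seriesSum.norm.pow 2 |>.const_mul _).intervalIntegrable _ _

theorem IsRHInf.summable_sq {f : RatFunc ℝ} (hf : IsRHInf f) :
    Summable fun n => impulseResponse f n ^ 2 := by
  refine hf.absSummable.hasSum_norm_sq.summable.congr fun n => ?_
  simp [complexSeries]

/-! ### Nonnegative matrices and Volterra recursions -/

section Volterra

open Filter Topology

variable {ι : Type*} [Fintype ι] [DecidableEq ι]

section

attribute [local instance] Matrix.linftyOpNormedRing Matrix.linftyOpNormedAlgebra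

/-- By Gelfand's formula `‖A ^ n‖ ≤ r ^ n` eventually, for any `r` strictly between the spectral
radius and `1`. -/
theorem exists_norm_pow_lt {A : Matrix ι ι ℂ} (hA : spectralRadius ℂ A < 1) {ε : ℝ} (hε : 0 < ε) :
    ∃ N : ℕ, ‖A ^ N‖ < ε := by
  have hG := spectrum.pow_nnnorm_pow_one_div_tendsto_nhds_spectralRadius A
  obtain ⟨r, hr1, hr2⟩ := ENNReal.lt_iff_exists_nnreal_btwn.1 hA
  have hr1' : r < 1 := by exact_mod_cast hr2
  have h1 := hG.eventually (gt_mem_nhds hr1)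
  have h2 : Tendsto (fun n : ℕ => (r : ℝ) ^ n) atTop (𝓝 0) :=
    tendsto_pow_atTop_nhds_zero_of_lt_one r.2 (by exact_mod_cast hr1')
  obtain ⟨N, hN, hN2, hN0⟩ :=
    (h1.and ((h2.eventually (gt_mem_nhds hε)).and (eventually_gt_atTop 0))).exists
  refine ⟨N, lt_of_le_of_lt ?_ hN2⟩
  have h3 := ENNReal.rpow_le_rpow hN.le (Nat.cast_nonneg N)
  rw [← ENNReal.rpow_mul, one_div, inv_mul_cancel₀ (by exact_mod_cast hN0.ne'), ENNReal.rpow_one,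
    ENNReal.rpow_natCast] at h3
  have h4 : ‖A ^ N‖₊ ≤ r ^ N := by exact_mod_cast h3
  exact_mod_cast h4

theorem exists_pow_mulVec_one_le {M : Matrix ι ι ℝ}
    (hM : spectralRadius ℂ (M.map (algebraMap ℝ ℂ)) < 1) :
    ∃ N : ℕ, ∀ a, (M ^ N).mulVec 1 a ≤ 1 / 2 := by
  obtain ⟨N, hN⟩ := exists_norm_pow_lt hM (ε := 1 / 2) (by norm_num)
  refine ⟨N, fun a => ?_⟩
  have h1 : ((M.map (algebraMap ℝ ℂ)) ^ N).mulVec 1 a = (((M ^ N).mulVec 1 a : ℝ) : ℂ) := by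
    have : (M.map (algebraMap ℝ ℂ)) ^ N = (M ^ N).map (algebraMap ℝ ℂ) := by
      have := map_pow (algebraMap ℝ ℂ).mapMatrix M N
      exact this.symm
    rw [this]
    simp [Matrix.mulVec, dotProduct]
  have h2 : ‖((M.map (algebraMap ℝ ℂ)) ^ N).mulVec 1‖ ≤ ‖(M.map (algebraMap ℝ ℂ)) ^ N‖ * ‖(1 : ι → ℂ)‖ :=
    Matrix.linfty_opNorm_mulVec _ _
  have h3 : ‖(1 : ι → ℂ)‖ ≤ 1 := (pi_norm_le_iff_of_nonneg zero_le_one).2 fun i => by simp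
  have h4 := norm_le_pi_norm (((M.map (algebraMap ℝ ℂ)) ^ N).mulVec 1) a
  rw [h1, Complex.norm_real] at h4
  calc (M ^ N).mulVec 1 a ≤ ‖(M ^ N).mulVec 1 a‖ := Real.le_norm_self _
    _ ≤ ‖(M.map (algebraMap ℝ ℂ)) ^ N‖ * ‖(1 : ι → ℂ)‖ := h4.trans h2
    _ ≤ ‖(M.map (algebraMap ℝ ℂ)) ^ N‖ * 1 := by gcongr
    _ ≤ 1 / 2 := by rw [mul_one]; exact hN.le

/-- In finite dimension the spectrum consists of eigenvalues, and the strict bound survives the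
supremum by compactness. The empty spectrum belongs to the empty index type. -/
theorem spectralRadius_lt_one_of_forall_eigenvalue {A : Matrix ι ι ℂ}
    (h : ∀ (z : ℂ) (w : ι → ℂ), w ≠ 0 → A.mulVec w = z • w → ‖z‖ < 1) :
    spectralRadius ℂ A < 1 := by
  rcases (spectrum ℂ A).eq_empty_or_nonempty with he | hne
  · simp [spectralRadius, he]
  · have := spectrum.spectralRadius_lt_of_forall_lt_of_nonempty hne (r := 1) fun z hz => by
      rw [← Matrix.spectrum_toLin', ← Module.End.hasEigenvalue_iff_mem_spectrum] at hz
      obtain ⟨w, hw⟩ := hz.exists_hasEigenvector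
      have h1 := hw.apply_eq_smul
      rw [Matrix.toLin'_apply] at h1
      exact_mod_cast h z w hw.2 h1
    exact_mod_cast this

end

theorem pow_mulVec_one_nonneg {M : Matrix ι ι ℝ} (hM : ∀ a b, 0 ≤ M a b) (n : ℕ) (a : ι) :
    0 ≤ (M ^ n).mulVec 1 a := by
  induction n generalizing a with
  | zero => simp
  | succ n ih =>
    rw [pow_succ', ← Matrix.mulVec_mulVec]
    exact Finset.sum_nonneg fun b _ => mul_nonneg (hM a b) (ih b)

/-- A nonnegative matrix with spectral radius less than one has a strictly superharmonic vector. -/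
theorem exists_superharmonic {M : Matrix ι ι ℝ} (hM0 : ∀ a b, 0 ≤ M a b)
    (hM : spectralRadius ℂ (M.map (algebraMap ℝ ℂ)) < 1) {B : ℝ} (hB : 0 ≤ B) :
    ∃ w : ι → ℝ, (∀ a, 0 ≤ w a) ∧ ∀ a, B + M.mulVec w a ≤ w a := by
  obtain ⟨N, hN⟩ := exists_pow_mulVec_one_le hM
  -- A truncated Neumann series: `w - M w = 2B (1 - M ^ N 1)`, which is at least `B` because `M ^ N
  -- 1 ≤ 1/2`.
  refine ⟨fun a => 2 * B * ∑ t ∈ Finset.range N, (M ^ t).mulVec 1 a, fun a => ?_, fun a => ?_⟩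
  · exact mul_nonneg (by positivity) (Finset.sum_nonneg fun t _ => pow_mulVec_one_nonneg hM0 t a)
  · have h1 : M.mulVec (fun a => 2 * B * ∑ t ∈ Finset.range N, (M ^ t).mulVec 1 a) a =
        2 * B * ∑ t ∈ Finset.range N, (M ^ (t + 1)).mulVec 1 a := by
      simp only [pow_succ', ← Matrix.mulVec_mulVec]
      simp only [Matrix.mulVec, dotProduct, Finset.mul_sum]
      rw [Finset.sum_comm]
      refine Finset.sum_congr rfl fun t _ => Finset.sum_congr rfl fun b _ =>
        Finset.sum_congr rfl fun _ _ => by ring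
    have h2 := Finset.sum_range_succ (fun t => (M ^ t).mulVec 1 a) N
    rw [Finset.sum_range_succ'] at h2
    have h3 : (M ^ 0).mulVec 1 a = 1 := by simp
    rw [h3] at h2
    rw [h1]
    nlinarith [hN a]

/-- A comparison principle: if `M x < x` holds in all rows of `M` that do not vanish, then the
spectral radius of the nonnegative matrix `M` is less than one. -/
theorem spectralRadius_lt_one_of_mulVec_lt {M : Matrix ι ι ℝ} (hM0 : ∀ a b, 0 ≤ M a b)
    {x : ι → ℝ} (hx : ∀ a, 0 ≤ x a) (h : ∀ a, M.mulVec x a < x a ∨ ∀ b, M a b = 0) :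
    spectralRadius ℂ (M.map (algebraMap ℝ ℂ)) < 1 := by
  refine spectralRadius_lt_one_of_forall_eigenvalue fun z w hw hzw => ?_
  by_contra hz
  rw [not_lt] at hz
  -- An eigenvalue of modulus at least one gives `|w| ≤ M |w|` entrywise.
  have hle : ∀ a, ‖w a‖ ≤ ∑ b, M a b * ‖w b‖ := by
    intro a
    have h1 := congrFun hzw a
    have h2 : ‖z‖ * ‖w a‖ ≤ ∑ b, M a b * ‖w b‖ := by
      rw [← norm_mul, ← smul_eq_mul, ← Pi.smul_apply, ← h1, Matrix.mulVec, dotProduct]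
      refine (norm_sum_le _ _).trans (Finset.sum_le_sum fun b _ => ?_)
      rw [norm_mul, Matrix.map_apply, norm_algebraMap', Real.norm_of_nonneg (hM0 a b)]
    exact (le_mul_of_one_le_left (norm_nonneg _) hz).trans h2
  have hpos : ∀ a, w a ≠ 0 → M.mulVec x a < x a := by
    intro a ha
    refine (h a).resolve_right fun h0 => ha ?_
    have := hle a
    simp only [h0, zero_mul, Finset.sum_const_zero] at this
    exact norm_le_zero_iff.1 this
  have hMx : ∀ a, 0 ≤ M.mulVec x a := fun a =>
    Finset.sum_nonneg fun b _ => mul_nonneg (hM0 a b) (hx b)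
  obtain ⟨a₀, ha₀⟩ : ∃ a, w a ≠ 0 := by
    by_contra! hall
    exact hw (funext hall)
  -- At an index maximizing `|w| / x`, with maximum `t`, one gets `|w_a| ≤ (M |w|)_a ≤ t (M x)_a < t
  -- x_a = |w_a|`. Where `x` vanishes, so does `w`, and the quotient is `0 / 0 = 0`.
  obtain ⟨a, -, hmax⟩ := Finset.exists_max_image Finset.univ (fun a => ‖w a‖ / x a)
    ⟨a₀, Finset.mem_univ a₀⟩
  set t := ‖w a‖ / x a with ht
  have ht0 : 0 < t := by
    refine lt_of_lt_of_le ?_ (hmax a₀ (Finset.mem_univ _))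
    exact div_pos (norm_pos_iff.2 ha₀) ((hMx a₀).trans_lt (hpos a₀ ha₀))
  have hwle : ∀ b, ‖w b‖ ≤ t * x b := by
    intro b
    rcases eq_or_ne (w b) 0 with hb | hb
    · rw [hb, norm_zero]
      exact mul_nonneg ht0.le (hx b)
    · rw [← div_le_iff₀ ((hMx b).trans_lt (hpos b hb))]
      exact hmax b (Finset.mem_univ _)
  have ha : w a ≠ 0 := by
    intro h0
    rw [ht, h0, norm_zero, zero_div] at ht0
    exact lt_irrefl _ ht0
  have hxa := (hMx a).trans_lt (hpos a ha)
  have h1 : ‖w a‖ = t * x a := by rw [ht, div_mul_cancel₀ _ hxa.ne']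
  have h2 : ∑ b, M a b * ‖w b‖ ≤ t * M.mulVec x a := by
    rw [Matrix.mulVec, dotProduct, Finset.mul_sum]
    refine Finset.sum_le_sum fun b _ => ?_
    rw [mul_left_comm]
    exact mul_le_mul_of_nonneg_left (hwle b) (hM0 a b)
  have h3 := mul_lt_mul_of_pos_left (hpos a ha) ht0
  linarith [hle a]

/-- A vector with `B + M w ≤ w` is a barrier constant in time: by strong induction `x k ≤ w`, as
partial sums of the kernel stay below `M`. -/
theorem volterra_bounded {Γ : ι → ι → ℕ → ℝ} {M : Matrix ι ι ℝ} (hΓ0 : ∀ a b s, 0 ≤ Γ a b s)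
    (hΓ : ∀ a b, HasSum (Γ a b) (M a b))
    (hM : spectralRadius ℂ (M.map (algebraMap ℝ ℂ)) < 1) {B : ℝ} (hB : 0 ≤ B) {x : ℕ → ι → ℝ}
    (hx : ∀ k a, x k a ≤ B + ∑ b, ∑ n ∈ Finset.range k, Γ a b (k - n) * x n b) :
    ∃ C, ∀ k a, x k a ≤ C := by
  have hM0 : ∀ a b, 0 ≤ M a b := fun a b => (hΓ a b).nonneg (hΓ0 a b)
  obtain ⟨w, hw0, hw⟩ := exists_superharmonic hM0 hM hB
  have h1 : ∀ k a, x k a ≤ w a := by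
    intro k
    induction k using Nat.strong_induction_on with
    | _ k ih =>
      intro a
      refine (hx k a).trans (le_trans ?_ (hw a))
      rw [Matrix.mulVec, dotProduct]
      gcongr with b _
      calc ∑ n ∈ Finset.range k, Γ a b (k - n) * x n b
          ≤ ∑ n ∈ Finset.range k, Γ a b (k - n) * w b := by
            refine Finset.sum_le_sum fun n hn => ?_
            exact mul_le_mul_of_nonneg_left (ih n (Finset.mem_range.1 hn) b) (hΓ0 _ _ _)
        _ ≤ M a b * w b := by
            rw [← Finset.sum_mul]
            refine mul_le_mul_of_nonneg_right ?_ (hw0 b)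
            have h2 : ∑ n ∈ Finset.range k, Γ a b (k - n) ≤
                ∑ n ∈ Finset.range (k + 1), Γ a b (k - n) :=
              Finset.sum_le_sum_of_subset_of_nonneg (Finset.range_mono (Nat.le_succ k))
                fun _ _ _ => hΓ0 _ _ _
            refine h2.trans ?_
            have h3 := Finset.sum_range_reflect (fun s => Γ a b s) (k + 1)
            simp only [Nat.add_sub_cancel] at h3
            rw [h3]
            exact sum_le_hasSum _ (fun _ _ => hΓ0 _ _ _) (hΓ a b)
  exact ⟨∑ a, w a, fun k a => (h1 k a).trans
    (Finset.single_le_sum (f := w) (fun b _ => hw0 b) (Finset.mem_univ a))⟩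

/-- Monotone forcing makes the solution monotone, so boundedness gives a limit `X`, and the equation
passes to the limit as `f(k₀) + M X ≤ X`. The alternative in `hpos` supplies strictness in every row
that is not zero. -/
theorem spectralRadius_lt_one_of_volterra_bounded {Γ : ι → ι → ℕ → ℝ} {M : Matrix ι ι ℝ}
    (hΓ0 : ∀ a b s, 0 ≤ Γ a b s) (hΓz : ∀ a b, Γ a b 0 = 0) (hΓ : ∀ a b, HasSum (Γ a b) (M a b))
    {f x : ℕ → ι → ℝ} (hx0 : ∀ k a, 0 ≤ x k a) (hf : ∀ a, Monotone fun k => f k a)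
    (hpos : ∀ a, (∃ k, 0 < f k a) ∨ ∀ b s, Γ a b s = 0)
    (hx : ∀ k a, x k a = f k a + ∑ b, ∑ n ∈ Finset.range k, Γ a b (k - n) * x n b)
    {C : ℝ} (hC : ∀ k a, x k a ≤ C) :
    spectralRadius ℂ (M.map (algebraMap ℝ ℂ)) < 1 := by
  have hM0 : ∀ a b, 0 ≤ M a b := fun a b => (hΓ a b).nonneg (hΓ0 a b)
  have hmono : ∀ a, Monotone fun k => x k a := by
    have key : ∀ k a, x k a ≤ x (k + 1) a := by
      intro k
      induction k using Nat.strong_induction_on with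
      | _ k ih =>
        intro a
        rw [hx k a, hx (k + 1) a]
        refine add_le_add (hf a (Nat.le_succ k)) (Finset.sum_le_sum fun b _ => ?_)
        -- After a shift by one the lags match; the extra term `n = 0` is nonnegative.
        rw [Finset.sum_range_succ']
        refine le_add_of_le_of_nonneg (Finset.sum_le_sum fun n hn => ?_)
          (mul_nonneg (hΓ0 _ _ _) (hx0 _ _))
        rw [Nat.add_sub_add_right]
        exact mul_le_mul_of_nonneg_left (ih n (Finset.mem_range.1 hn) b) (hΓ0 _ _ _)
    exact fun a => monotone_nat_of_le_succ fun k => key k a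
  have hbdd : ∀ a, BddAbove (Set.range fun k => x k a) := fun a =>
    ⟨C, by rintro _ ⟨k, rfl⟩; exact hC k a⟩
  set X : ι → ℝ := fun a => ⨆ k, x k a with hX
  have hlim : ∀ a, Tendsto (fun k => x k a) atTop (𝓝 (X a)) := fun a =>
    tendsto_atTop_ciSup (hmono a) (hbdd a)
  have hX0 : ∀ a, 0 ≤ X a := fun a => ge_of_tendsto' (hlim a) fun k => hx0 k a
  have hge : ∀ a k₀, f k₀ a + M.mulVec X a ≤ X a := by
    intro a k₀
    -- The kernel is cut at `S` lags so that only finitely many limits `k → ∞` are taken; `S → ∞`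
    -- comes afterwards.
    have hS : ∀ S : ℕ, f k₀ a + ∑ b, ∑ s ∈ Finset.range S, Γ a b s * X b ≤ X a := by
      intro S
      have hl : Tendsto (fun k => f k₀ a + ∑ b, ∑ s ∈ Finset.range S, Γ a b s * x (k - s) b) atTop
          (𝓝 (f k₀ a + ∑ b, ∑ s ∈ Finset.range S, Γ a b s * X b)) := by
        refine tendsto_const_nhds.add (tendsto_finsetSum _ fun b _ => tendsto_finsetSum _ fun s _ =>
          Tendsto.const_mul _ ?_)
        exact (hlim b).comp (tendsto_sub_atTop_nat s)
      refine le_of_tendsto_of_tendsto hl (hlim a) ?_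
      filter_upwards [eventually_ge_atTop k₀, eventually_ge_atTop S] with k hk hkS
      rw [hx k a]
      refine add_le_add (hf a hk) (Finset.sum_le_sum fun b _ => ?_)
      have h1 : ∑ n ∈ Finset.range k, Γ a b (k - n) * x n b =
          ∑ n ∈ Finset.range (k + 1), Γ a b (k - n) * x n b := by
        rw [Finset.sum_range_succ, Nat.sub_self, hΓz, zero_mul, add_zero]
      have h2 := Finset.sum_range_reflect (fun s => Γ a b s * x (k - s) b) (k + 1)
      simp only [Nat.add_sub_cancel] at h2
      rw [h1]
      calc ∑ s ∈ Finset.range S, Γ a b s * x (k - s) b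
          ≤ ∑ s ∈ Finset.range (k + 1), Γ a b s * x (k - s) b :=
            Finset.sum_le_sum_of_subset_of_nonneg (Finset.range_mono (by omega))
              fun _ _ _ => mul_nonneg (hΓ0 _ _ _) (hx0 _ _)
        _ = ∑ n ∈ Finset.range (k + 1), Γ a b (k - n) * x n b := by
            rw [← h2]
            refine Finset.sum_congr rfl fun n hn => ?_
            rw [Nat.sub_sub_self (Nat.lt_succ_iff.1 (Finset.mem_range.1 hn))]
    refine le_of_tendsto' (x := atTop) (f := fun S => f k₀ a +
      ∑ b, ∑ s ∈ Finset.range S, Γ a b s * X b) ?_ hS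
    refine tendsto_const_nhds.add (tendsto_finsetSum _ fun b _ => ?_)
    simp only [← Finset.sum_mul]
    exact (hΓ a b).tendsto_sum_nat.mul_const _
  refine spectralRadius_lt_one_of_mulVec_lt hM0 hX0 fun a => ?_
  rcases hpos a with ⟨k, hk⟩ | h0
  · left
    linarith [hge a k]
  · right
    intro b
    have : Γ a b = fun _ => 0 := funext (h0 b)
    exact (hΓ a b).unique (this ▸ hasSum_zero)

end Volterra

/-! ### Second moments -/

section Moments

/-- On the π-system of sets `s₁ ∩ s₂` generating `V ⊔ B`, first `s₁` splits off and then `a` from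
`s₂`. It is used with one delay, the other delays and the input as `A`, `B`, `V`. -/
theorem indep_sup_right {Ω : Type*} [mΩ : MeasurableSpace Ω] {μ : Measure Ω} [IsProbabilityMeasure μ]
    {A B V : MeasurableSpace Ω} (hA : A ≤ mΩ) (hB : B ≤ mΩ) (hV : V ≤ mΩ) (hAB : Indep A B μ)
    (hVAB : Indep V (A ⊔ B) μ) : Indep A (V ⊔ B) μ := by
  set p : Set (Set Ω) := {t | ∃ s₁ s₂, MeasurableSet[V] s₁ ∧ MeasurableSet[B] s₂ ∧ t = s₁ ∩ s₂} with hp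
  have hpi : IsPiSystem p := by
    rintro _ ⟨s₁, s₂, h₁, h₂, rfl⟩ _ ⟨t₁, t₂, h₁', h₂', rfl⟩ -
    exact ⟨s₁ ∩ t₁, s₂ ∩ t₂, h₁.inter h₁', h₂.inter h₂', Set.inter_inter_inter_comm _ _ _ _⟩
  have hgen : V ⊔ B = MeasurableSpace.generateFrom p := by
    apply le_antisymm
    · refine sup_le (fun s hs => ?_) (fun s hs => ?_)
      · exact MeasurableSpace.measurableSet_generateFrom
          ⟨s, Set.univ, hs, MeasurableSet.univ, (Set.inter_univ s).symm⟩
      · exact MeasurableSpace.measurableSet_generateFrom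
          ⟨Set.univ, s, MeasurableSet.univ, hs, (Set.univ_inter s).symm⟩
    · refine MeasurableSpace.generateFrom_le ?_
      rintro _ ⟨s₁, s₂, h₁, h₂, rfl⟩
      exact MeasurableSet.inter (le_sup_left (a := V) _ h₁) (le_sup_right (a := V) (b := B) _ h₂)
  refine IndepSets.indep hA (sup_le hV hB) (p1 := {s | MeasurableSet[A] s})
    (fun s hs t ht _ => MeasurableSet.inter hs ht) hpi
    (@MeasurableSpace.generateFrom_measurableSet Ω A).symm hgen ?_
  rw [IndepSets_iff]
  rintro a _ ha ⟨s₁, s₂, h₁, h₂, rfl⟩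
  rw [Indep_iff] at hAB hVAB
  have ha' : MeasurableSet[A ⊔ B] a := le_sup_left (a := A) _ ha
  have h₂' : MeasurableSet[A ⊔ B] s₂ := le_sup_right (a := A) (b := B) _ h₂
  rw [Set.inter_left_comm, hVAB s₁ (a ∩ s₂) h₁ (ha'.inter h₂'), hAB a s₂ ha h₂,
    hVAB s₁ s₂ h₁ h₂']
  ring

theorem integral_sq_sum_of_orthogonal {Ω ι : Type*} [MeasurableSpace Ω] {μ : Measure Ω}
    (s : Finset ι) {X : ι → Ω → ℝ} (hX : ∀ i ∈ s, MemLp (X i) 2 μ)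
    (h : ∀ i ∈ s, ∀ j ∈ s, i ≠ j → ∫ ω, X i ω * X j ω ∂μ = 0) :
    ∫ ω, (∑ i ∈ s, X i ω) ^ 2 ∂μ = ∑ i ∈ s, ∫ ω, X i ω ^ 2 ∂μ := by
  have hint : ∀ i ∈ s, ∀ j ∈ s, Integrable (fun ω => X i ω * X j ω) μ := fun i hi j hj =>
    (hX i hi).integrable_mul (hX j hj)
  simp only [sq, Finset.sum_mul_sum]
  rw [integral_finsetSum _ fun i hi => integrable_finsetSum _ fun j hj => hint i hi j hj]
  refine Finset.sum_congr rfl fun i hi => ?_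
  rw [integral_finsetSum _ fun j hj => hint i hi j hj]
  exact Finset.sum_eq_single_of_mem i hi fun j hj hji => h i hi j hj hji.symm

variable {m : ℕ} {c : Fin m → Channel} {Ω : Type}
  {χ : Fin m → ℕ → Ω → ℕ} {v u : ℕ → Ω → Fin m → ℝ}

/-- A strictly causal linear recursion with coefficients that depend on the delays. -/
def IsDelayRecursion (g : Fin m → Fin m → ℕ → ℝ) (A : Fin m → Fin m → ℕ → ℕ → ℝ)
    (χ : Fin m → ℕ → Ω → ℕ) (v u : ℕ → Ω → Fin m → ℝ) : Prop :=
  ∀ ω k a, u k ω a = ∑ b, ∑ n ∈ Finset.range (k + 1), g a b (k - n) * v n ω b -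
    ∑ b, ∑ n ∈ Finset.range k, A a b (χ b n ω) (k - n) * u n ω b

variable {g : Fin m → Fin m → ℕ → ℝ} {A : Fin m → Fin m → ℕ → ℕ → ℝ}

/-- Strict causality: `u k` sees only delays before time `k`. The σ-algebra is arbitrary so that it
may omit a delay at time `k`. -/
theorem IsDelayRecursion.measurable (hu : IsDelayRecursion g A χ v u) (𝓖 : MeasurableSpace Ω)
    (hv : ∀ n, Measurable[𝓖] (v n)) (k : ℕ) (hχ : ∀ b, ∀ n < k, Measurable[𝓖] (χ b n)) (a : Fin m) :
    Measurable[𝓖] fun ω => u k ω a := by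
  induction k using Nat.strong_induction_on generalizing a with
  | _ k ih =>
    have h : (fun ω => u k ω a) = _ := funext fun ω => hu ω k a
    rw [h]
    refine Measurable.sub ?_ ?_
    · refine Finset.measurable_sum _ fun b _ => Finset.measurable_sum _ fun n _ => ?_
      exact ((measurable_pi_apply b).comp (hv n)).const_mul _
    · refine Finset.measurable_sum _ fun b _ => Finset.measurable_sum _ fun n hn => ?_
      have hn' := Finset.mem_range.1 hn
      refine Measurable.mul ?_ (ih n hn' (fun b l hl => hχ b l (hl.trans hn')) b)
      exact (measurable_from_nat (f := fun x => A a b x (k - n))).comp (hχ b n hn')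

/-- The information carried by the input and by all delays but one. -/
@[reducible]
def exceptSigma (v : ℕ → Ω → Fin m → ℝ) (χ : Fin m → ℕ → Ω → ℕ) (s : Fin m × ℕ) :
    MeasurableSpace Ω :=
  MeasurableSpace.comap (fun ω k => v k ω) inferInstance ⊔
    ⨆ t ∈ ({s}ᶜ : Set (Fin m × ℕ)), MeasurableSpace.comap (χ t.1 t.2) inferInstance

theorem measurable_input_exceptSigma (s : Fin m × ℕ) (n : ℕ) :
    Measurable[exceptSigma v χ s] (v n) := by
  have h1 : Measurable[MeasurableSpace.comap (fun ω k => v k ω) inferInstance]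
      (fun ω k => v k ω) := comap_measurable _
  exact ((measurable_pi_apply n).comp h1).mono le_sup_left le_rfl

theorem measurable_delay_exceptSigma {s t : Fin m × ℕ} (hst : t ≠ s) :
    Measurable[exceptSigma v χ s] (χ t.1 t.2) := by
  refine (comap_measurable (χ t.1 t.2)).mono ?_ le_rfl
  exact (le_iSup₂_of_le (f := fun (t : Fin m × ℕ) (_ : t ∈ ({s}ᶜ : Set (Fin m × ℕ))) =>
    MeasurableSpace.comap (χ t.1 t.2) inferInstance) t hst le_rfl).trans le_sup_right

variable [mΩ : MeasurableSpace Ω] {μ : Measure Ω}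

theorem exceptSigma_le (hχ : IsDelayProcess c χ μ) (hv : ∀ k, Measurable (v k)) (s : Fin m × ℕ) :
    exceptSigma v χ s ≤ mΩ :=
  sup_le (measurable_pi_iff.2 hv).comap_le (iSup₂_le fun t _ => (hχ.measurable t.1 t.2).comap_le)

theorem IsDelayProcess.indep_exceptSigma [IsProbabilityMeasure μ] (hχ : IsDelayProcess c χ μ)
    (hv : ∀ k, Measurable (v k))
    (hind : IndepFun (fun ω k => v k ω) (fun ω i k => χ i k ω) μ) (s : Fin m × ℕ) :
    Indep (MeasurableSpace.comap (χ s.1 s.2) inferInstance) (exceptSigma v χ s) μ := by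
  have hle : ∀ t : Fin m × ℕ, MeasurableSpace.comap (χ t.1 t.2) inferInstance ≤ mΩ :=
    fun t => (hχ.measurable t.1 t.2).comap_le
  refine indep_sup_right (hle s) (iSup₂_le fun t _ => hle t) (measurable_pi_iff.2 hv).comap_le ?_ ?_
  · have := indep_iSup_of_disjoint hle hχ.indep.iIndep (S := {s}) (T := {s}ᶜ)
      disjoint_compl_right
    simpa only [Set.mem_singleton_iff, iSup_iSup_eq_left] using this
  · have hpath : ∀ t : Fin m × ℕ, MeasurableSpace.comap (χ t.1 t.2) inferInstance ≤
        MeasurableSpace.comap (fun ω i k => χ i k ω) inferInstance := by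
      intro t
      have h1 : Measurable[MeasurableSpace.comap (fun ω i k => χ i k ω) inferInstance]
        (fun ω i k => χ i k ω) := comap_measurable _
      exact (((measurable_pi_apply t.2).comp (measurable_pi_apply t.1)).comp h1).comap_le
    exact indep_of_indep_of_le_right ((IndepFun_iff_Indep _ _ _).1 hind)
      (sup_le (hpath s) (iSup₂_le fun t _ => hpath t))

theorem IsDelayProcess.integral_comp (hχ : IsDelayProcess c χ μ) [IsProbabilityMeasure μ] (b : Fin m)
    (n : ℕ) (φ : ℕ → ℝ) :
    ∫ ω, φ (χ b n ω) ∂μ = ∑ x ∈ Finset.range ((c b).maxDelay + 1), (c b).prob x * φ x := by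
  have hms : ∀ x, MeasurableSet {ω | χ b n ω = x} := fun x =>
    hχ.measurable b n (measurableSet_singleton x)
  have h1 : ∀ ω, φ (χ b n ω) = ∑ x ∈ Finset.range ((c b).maxDelay + 1),
      Set.indicator {ω | χ b n ω = x} (fun _ => φ x) ω := by
    intro ω
    rw [Finset.sum_eq_single_of_mem (χ b n ω)
      (Finset.mem_range.2 (Nat.lt_succ_of_le (hχ.le_maxDelay b n ω)))]
    · simp
    · intro x _ hx
      exact Set.indicator_of_notMem (fun h : χ b n ω = x => hx h.symm) _
  simp only [h1]
  rw [integral_finsetSum _ fun x _ => (integrable_const _).indicator (hms x)]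
  refine Finset.sum_congr rfl fun x hx => ?_
  have hx' := Nat.lt_succ_iff.1 (Finset.mem_range.1 hx)
  rw [integral_indicator_const _ (hms x), measureReal_def, hχ.law b n x hx',
    ENNReal.toReal_ofReal ((c b).prob_nonneg x hx'), smul_eq_mul]

theorem IsDelayProcess.integral_comp_mul [IsProbabilityMeasure μ] (hχ : IsDelayProcess c χ μ)
    (hv : ∀ k, Measurable (v k))
    (hind : IndepFun (fun ω k => v k ω) (fun ω i k => χ i k ω) μ) (b : Fin m) (n : ℕ) (φ : ℕ → ℝ)
    {Z : Ω → ℝ} (hZ : Measurable[exceptSigma v χ (b, n)] Z) :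
    ∫ ω, φ (χ b n ω) * Z ω ∂μ =
      (∑ x ∈ Finset.range ((c b).maxDelay + 1), (c b).prob x * φ x) * ∫ ω, Z ω ∂μ := by
  have hi : IndepFun (fun ω => φ (χ b n ω)) Z μ := by
    rw [IndepFun_iff_Indep]
    refine indep_of_indep_of_le_left (indep_of_indep_of_le_right
      (hχ.indep_exceptSigma hv hind (b, n)) hZ.comap_le) ?_
    exact ((measurable_from_nat (f := φ)).comp (comap_measurable (χ b n))).comap_le
  rw [hi.integral_fun_mul_eq_mul_integral, hχ.integral_comp]
  · exact ((measurable_from_nat (f := φ)).comp (hχ.measurable b n)).aestronglyMeasurable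
  · exact (hZ.mono (exceptSigma_le hχ hv _) le_rfl).aestronglyMeasurable

theorem IsDelayProcess.memLp_mul (hχ : IsDelayProcess c χ μ) (b : Fin m) (n : ℕ) (φ : ℕ → ℝ)
    {Z : Ω → ℝ} (hZ : MemLp Z 2 μ) : MemLp (fun ω => φ (χ b n ω) * Z ω) 2 μ := by
  refine MemLp.of_le_mul (c := ∑ x ∈ Finset.range ((c b).maxDelay + 1), ‖φ x‖) hZ ?_ ?_
  · exact ((measurable_from_nat (f := φ)).comp (hχ.measurable b n)).aestronglyMeasurable.mul
      hZ.aestronglyMeasurable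
  · refine Filter.Eventually.of_forall fun ω => ?_
    rw [norm_mul]
    gcongr
    exact Finset.single_le_sum (f := fun x => ‖φ x‖) (fun _ _ => norm_nonneg _)
      (Finset.mem_range.2 (Nat.lt_succ_of_le (hχ.le_maxDelay b n ω)))

theorem IsDelayRecursion.memLp (hu : IsDelayRecursion g A χ v u) (hχ : IsDelayProcess c χ μ)
    (hv : ∀ k i, MemLp (fun ω => v k ω i) 2 μ) (k : ℕ) (a : Fin m) :
    MemLp (fun ω => u k ω a) 2 μ := by
  induction k using Nat.strong_induction_on generalizing a with
  | _ k ih =>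
    have h : (fun ω => u k ω a) = _ := funext fun ω => hu ω k a
    rw [h]
    refine MemLp.sub ?_ ?_
    · exact memLp_finsetSum _ fun b _ => memLp_finsetSum _ fun n _ => (hv n b).const_mul _
    · exact memLp_finsetSum _ fun b _ => memLp_finsetSum _ fun n hn =>
        hχ.memLp_mul b n (fun x => A a b x (k - n)) (ih n (Finset.mem_range.1 hn) b)

theorem IsWhiteNoise.integral_mul (hv : IsWhiteNoise v μ) {s t : Fin m × ℕ} (hst : s ≠ t) :
    ∫ ω, v s.2 ω s.1 * v t.2 ω t.1 ∂μ = 0 := by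
  by_cases h : s.2 = t.2
  · rw [h]
    exact hv.uncorrelated _ _ _ fun h' => hst (Prod.ext h' h)
  · have hi : IndepFun (fun ω => v s.2 ω s.1) (fun ω => v t.2 ω t.1) μ :=
      (hv.indep.indepFun h).comp (measurable_pi_apply s.1) (measurable_pi_apply t.1)
    rw [hi.integral_fun_mul_eq_mul_integral (hv.memLp _ _).aestronglyMeasurable
      (hv.memLp _ _).aestronglyMeasurable, hv.zero_mean, zero_mul]

theorem IsWhiteNoise.integral_sq (hv : IsWhiteNoise v μ) (n : ℕ) (b : Fin m) :
    ∫ ω, v n ω b ^ 2 ∂μ = ∫ ω, v 0 ω b ^ 2 ∂μ :=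
  ((hv.identDistrib n).comp (u := fun x : Fin m → ℝ => x b ^ 2) (by fun_prop)).integral_eq

/-- The recursion for the second moments. -/
theorem IsDelayRecursion.integral_sq [IsProbabilityMeasure μ] (hu : IsDelayRecursion g A χ v u)
    (hχ : IsDelayProcess c χ μ) (hv : IsWhiteNoise v μ)
    (hind : IndepFun (fun ω k => v k ω) (fun ω i k => χ i k ω) μ)
    (hA : ∀ a b s, ∑ x ∈ Finset.range ((c b).maxDelay + 1), (c b).prob x * A a b x s = 0)
    (k : ℕ) (a : Fin m) :
    ∫ ω, u k ω a ^ 2 ∂μ =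
      ∑ b, ∑ n ∈ Finset.range (k + 1), g a b (k - n) ^ 2 * ∫ ω, v 0 ω b ^ 2 ∂μ +
      ∑ b, ∑ n ∈ Finset.range k, (∑ x ∈ Finset.range ((c b).maxDelay + 1),
        (c b).prob x * A a b x (k - n) ^ 2) * ∫ ω, u n ω b ^ 2 ∂μ := by
  -- Input terms (`inl`) and feedback terms (`inr`) form one family, to which Pythagoras applies
  -- once all pairs are shown orthogonal.
  set S₁ : Finset (Fin m × ℕ) := Finset.univ ×ˢ Finset.range (k + 1) with hS₁
  set S₂ : Finset (Fin m × ℕ) := Finset.univ ×ˢ Finset.range k with hS₂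
  set X : (Fin m × ℕ) ⊕ (Fin m × ℕ) → Ω → ℝ := Sum.elim
    (fun s ω => g a s.1 (k - s.2) * v s.2 ω s.1)
    (fun s ω => -(A a s.1 (χ s.1 s.2 ω) (k - s.2) * u s.2 ω s.1)) with hX
  have huX : ∀ ω, u k ω a = ∑ i ∈ S₁.disjSum S₂, X i ω := by
    intro ω
    rw [Finset.sum_disjSum, hS₁, hS₂, Finset.sum_product, Finset.sum_product, hu ω k a, hX]
    simp only [Sum.elim_inl, Sum.elim_inr, Finset.sum_neg_distrib]
    ring
  have hvm := hv.measurable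
  have hum : ∀ (s : Fin m × ℕ) (n : ℕ) (b : Fin m), n ≤ s.2 →
      Measurable[exceptSigma v χ s] fun ω => u n ω b := fun s n b hn =>
    hu.measurable _ (measurable_input_exceptSigma s) n (fun b' l hl =>
      measurable_delay_exceptSigma (t := (b', l)) fun h => by
        rw [← h] at hn
        exact absurd hl (not_lt.2 hn)) b
  have horth : ∀ (s : Fin m × ℕ) (Z : Ω → ℝ), Measurable[exceptSigma v χ s] Z →
      ∫ ω, A a s.1 (χ s.1 s.2 ω) (k - s.2) * Z ω ∂μ = 0 := fun s Z hZ => by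
    rw [hχ.integral_comp_mul hvm hind s.1 s.2 (fun x => A a s.1 x (k - s.2)) hZ, hA, zero_mul]
  have hvu : ∀ s t : Fin m × ℕ, ∫ ω, X (Sum.inl s) ω * X (Sum.inr t) ω ∂μ = 0 := by
    intro s t
    rw [← horth t (fun ω => u t.2 ω t.1 * -(g a s.1 (k - s.2) * v s.2 ω s.1))]
    · refine integral_congr_ae (Filter.Eventually.of_forall fun ω => ?_)
      simp only [hX, Sum.elim_inl, Sum.elim_inr]
      ring
    · refine Measurable.mul (hum t t.2 t.1 le_rfl) (Measurable.neg (Measurable.const_mul ?_ _))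
      exact (measurable_pi_apply s.1).comp (measurable_input_exceptSigma t s.2)
  -- The delay of `s`, sent no earlier than `t`, is averaged out: every other factor is measurable
  -- without it, including when both are sent at the same time on different channels.
  have huu : ∀ s t : Fin m × ℕ, s ≠ t → t.2 ≤ s.2 →
      ∫ ω, X (Sum.inr s) ω * X (Sum.inr t) ω ∂μ = 0 := by
    intro s t hst hle
    rw [← horth s (fun ω => u s.2 ω s.1 * (A a t.1 (χ t.1 t.2 ω) (k - t.2) * u t.2 ω t.1))]
    · refine integral_congr_ae (Filter.Eventually.of_forall fun ω => ?_)
      simp only [hX, Sum.elim_inr]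
      ring
    · refine Measurable.mul (hum s s.2 s.1 le_rfl) (Measurable.mul ?_ (hum s t.2 t.1 hle))
      exact (measurable_from_nat (f := fun x => A a t.1 x (k - t.2))).comp
        (measurable_delay_exceptSigma hst.symm)
  simp only [huX]
  rw [integral_sq_sum_of_orthogonal, Finset.sum_disjSum]
  · rw [hS₁, hS₂, Finset.sum_product, Finset.sum_product]
    congr 1
    · refine Finset.sum_congr rfl fun b _ => Finset.sum_congr rfl fun n _ => ?_
      simp only [hX, Sum.elim_inl, mul_pow]
      rw [integral_const_mul, hv.integral_sq]
    · refine Finset.sum_congr rfl fun b _ => Finset.sum_congr rfl fun n _ => ?_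
      simp only [hX, Sum.elim_inr, neg_sq, mul_pow]
      exact hχ.integral_comp_mul hvm hind b n (fun x => A a b x (k - n) ^ 2)
        ((hum (b, n) n b le_rfl).pow_const 2)
  · rintro (s | s) _
    · exact (hv.memLp s.2 s.1).const_mul _
    · exact (hχ.memLp_mul s.1 s.2 (fun x => A a s.1 x (k - s.2))
        (hu.memLp hχ hv.memLp s.2 s.1)).neg
  · rintro (s | s) _ (t | t) _ hst
    · have hst' : s ≠ t := fun h => hst (by rw [h])
      simp only [hX, Sum.elim_inl]
      have hr : ∀ ω, g a s.1 (k - s.2) * v s.2 ω s.1 * (g a t.1 (k - t.2) * v t.2 ω t.1) =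
          g a s.1 (k - s.2) * g a t.1 (k - t.2) * (v s.2 ω s.1 * v t.2 ω t.1) := fun ω => by ring
      simp only [hr]
      rw [integral_const_mul, hv.integral_mul hst', mul_zero]
    · exact hvu s t
    · simp only [mul_comm (X (Sum.inr s) _)]
      exact hvu t s
    · have hst' : s ≠ t := fun h => hst (by rw [h])
      rcases le_total t.2 s.2 with hle | hle
      · exact huu s t hst' hle
      · simp only [mul_comm (X (Sum.inr s) _)]
        exact huu t s hst'.symm hle

end Moments

/-! ### Existence of the loop and of the random processes -/

/-- Each iteration of `F` fixes one more value for good, whatever the start; the solution is the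
diagonal of the iterates. -/
theorem exists_eq_of_strictlyCausal {α : Type*} [Inhabited α] (F : (ℕ → α) → ℕ → α)
    (hF : ∀ k y y', (∀ n < k, y n = y' n) → F y k = F y' k) : ∃ y, ∀ k, y k = F y k := by
  set Y : ℕ → ℕ → α := fun n => F^[n] default with hY
  have hsucc : ∀ n, Y (n + 1) = F (Y n) := fun n => Function.iterate_succ_apply' F n _
  have hagree : ∀ n j, n ≤ j → ∀ k < n, Y j k = Y n k := by
    intro n
    induction n with
    | zero => intro j _ k hk; omega
    | succ n ih =>
      intro j hj k hk
      obtain ⟨i, rfl⟩ : ∃ i, j = i + 1 := ⟨j - 1, by omega⟩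
      rw [hsucc, hsucc]
      exact hF k _ _ fun l hl => ih i (by omega) l (by omega)
  refine ⟨fun k => Y (k + 1) k, fun k => ?_⟩
  change Y (k + 1) k = _
  rw [hsucc]
  exact hF k _ _ fun n hn => hagree (n + 1) k hn n (Nat.lt_succ_self n)

section System

variable {m q : ℕ} {P : Matrix (Fin q) (Fin m) (RatFunc ℝ)}

/-- Mean-square stability quantifies over given loop signals, so necessity needs actual ones. Strict
properness of `P` makes the loop map strictly causal. -/
theorem exists_isLoopPath (hP : ∀ i j, IsStrictlyProper (P i j))
    (K : Matrix (Fin m) (Fin q) (RatFunc ℝ)) (c : Fin m → Channel) (χ : Fin m → ℕ → ℕ)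
    (v : ℕ → Fin m → ℝ) : ∃ e u y, IsLoopPath P K c χ v e u y := by
  obtain ⟨y, hy⟩ := exists_eq_of_strictlyCausal (fun (y : ℕ → Fin q → ℝ) k =>
    ltiOutput P (fun n i => v n i - (c i).output (χ i) (fun l => ltiOutput K y l i) n) k) (by
      intro k y y' hyy
      ext i
      simp only [ltiOutput]
      refine Finset.sum_congr rfl fun n hn => Finset.sum_congr rfl fun j _ => ?_
      rcases (Nat.lt_succ_iff.1 (Finset.mem_range.1 hn)).eq_or_lt with h | h
      · rw [h, Nat.sub_self, (hP i j).impulseResponse_zero, zero_mul, zero_mul]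
      · congr 2
        simp only [Channel.output]
        refine Finset.sum_congr rfl fun l _ => ?_
        split_ifs with hl
        · congr 1
          refine Finset.sum_congr rfl fun t ht => ?_
          rw [hyy t (by have := Finset.mem_range.1 ht; omega)]
        · rfl)
  exact ⟨fun k i => v k i - (c i).uncertaintyOutput (χ i) (fun l => ltiOutput K y l i) k,
    ltiOutput K y, y, hy, fun k => rfl, fun k i => rfl⟩

end System

theorem iIndepFun_comp_of_measurePreserving {ι Ω Ω' β : Type*} [MeasurableSpace Ω]
    [MeasurableSpace Ω'] [MeasurableSpace β] {μ : Measure Ω} {ν : Measure Ω'}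
    [IsProbabilityMeasure μ] [IsProbabilityMeasure ν] {φ : Ω → Ω'} (hφ : MeasurePreserving φ μ ν)
    {X : ι → Ω' → β} (hX : ∀ i, Measurable (X i)) (h : iIndepFun X ν) :
    iIndepFun (fun i ω => X i (φ ω)) μ := by
  have hX' : ∀ i, Measurable fun ω => X i (φ ω) := fun i => (hX i).comp hφ.measurable
  rw [iIndepFun_iff_map_fun_eq_infinitePi_map hX']
  rw [iIndepFun_iff_map_fun_eq_infinitePi_map hX, ← hφ.map_eq,
    Measure.map_map (measurable_pi_iff.2 hX) hφ.measurable] at h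
  refine h.trans ?_
  congr 1
  ext1 i
  rw [Measure.map_map (hX i) hφ.measurable]
  rfl

namespace Channel

variable (c : Channel)

/-- The law of the delay of a channel. -/
noncomputable def delayLaw : Measure (Fin (c.maxDelay + 1)) :=
  Measure.sum fun j : Fin (c.maxDelay + 1) => ENNReal.ofReal (c.prob j) • Measure.dirac j

theorem delayLaw_singleton (j : Fin (c.maxDelay + 1)) :
    c.delayLaw {j} = ENNReal.ofReal (c.prob j) := by
  rw [delayLaw, Measure.sum_apply _ (measurableSet_singleton j), tsum_fintype,
    Finset.sum_eq_single j]
  · simp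
  · intro i _ hij
    simp [hij]
  · simp

instance : IsProbabilityMeasure c.delayLaw := by
  constructor
  rw [delayLaw, Measure.sum_apply _ MeasurableSet.univ, tsum_fintype]
  simp only [Measure.smul_apply, measure_univ, smul_eq_mul, mul_one]
  rw [← ENNReal.ofReal_sum_of_nonneg fun (j : Fin (c.maxDelay + 1)) _ =>
      c.prob_nonneg j (Nat.lt_succ_iff.1 j.2),
    Fin.sum_univ_eq_sum_range, c.prob_sum, ENNReal.ofReal_one]

end Channel

/-- There are delay processes and a standard Gaussian white noise independent of them. -/
theorem exists_delayProcess_whiteNoise {m : ℕ} (c : Fin m → Channel) :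
    ∃ (Ω : Type) (_ : MeasurableSpace Ω) (μ : Measure Ω) (_ : IsProbabilityMeasure μ)
      (χ : Fin m → ℕ → Ω → ℕ) (v : ℕ → Ω → Fin m → ℝ),
      IsDelayProcess c χ μ ∧ IsWhiteNoise v μ ∧
      IndepFun (fun ω k => v k ω) (fun ω i k => χ i k ω) μ ∧
      ∀ k i, ∫ ω, v k ω i ^ 2 ∂μ = 1 := by
  -- Delays live in `Fin`, so their bound holds at every sample point and not only almost surely.
  -- Independence from the noise comes from the product measure.
  set μ₁ : Measure ((s : Fin m × ℕ) → Fin ((c s.1).maxDelay + 1)) :=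
    Measure.infinitePi fun s => (c s.1).delayLaw with hμ₁
  set γ : Measure (Fin m → ℝ) := Measure.pi fun _ => gaussianReal 0 1 with hγ
  set μ₂ : Measure (ℕ → Fin m → ℝ) := Measure.infinitePi fun _ => γ with hμ₂
  have hfst : MeasurePreserving Prod.fst (μ₁.prod μ₂) μ₁ := measurePreserving_fst
  have hsnd : MeasurePreserving Prod.snd (μ₁.prod μ₂) μ₂ := measurePreserving_snd
  have hev : ∀ k : ℕ, MeasurePreserving (fun ω : _ × (ℕ → Fin m → ℝ) => ω.2 k) (μ₁.prod μ₂) γ :=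
    fun k => (measurePreserving_eval_infinitePi (fun _ => γ) k).comp hsnd
  have hev' : ∀ (k : ℕ) (i : Fin m), MeasurePreserving
      (fun ω : _ × (ℕ → Fin m → ℝ) => ω.2 k i) (μ₁.prod μ₂) (gaussianReal 0 1) :=
    fun k i => (measurePreserving_eval (fun _ : Fin m => gaussianReal 0 1) i).comp (hev k)
  have hint : ∀ (k : ℕ) (i : Fin m) (f : ℝ → ℝ), Measurable f →
      ∫ ω, f (ω.2 k i) ∂(μ₁.prod μ₂) = ∫ x, f x ∂(gaussianReal 0 1) := by
    intro k i f hf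
    rw [← (hev' k i).map_eq, integral_map (hev' k i).measurable.aemeasurable
      hf.aestronglyMeasurable]
  refine ⟨_, inferInstance, μ₁.prod μ₂, inferInstance, fun i k ω => (ω.1 (i, k) : ℕ),
    fun k ω => ω.2 k, ?_, ?_, ?_, ?_⟩
  · refine ⟨fun i k => by fun_prop, fun i k ω => Nat.lt_succ_iff.1 (ω.1 (i, k)).2, ?_, ?_⟩
    · intro i k j hj
      have hp : MeasurePreserving (fun ω : ((s : Fin m × ℕ) → Fin ((c s.1).maxDelay + 1)) ×
          (ℕ → Fin m → ℝ) => ω.1 (i, k)) (μ₁.prod μ₂) (c i).delayLaw :=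
        (measurePreserving_eval_infinitePi (fun s : Fin m × ℕ => (c s.1).delayLaw) (i, k)).comp hfst
      have h1 := hp.measure_preimage
        (measurableSet_singleton (⟨j, Nat.lt_succ_of_le hj⟩ : Fin ((c i).maxDelay + 1))).nullMeasurableSet
      rw [(c i).delayLaw_singleton] at h1
      rw [← h1]
      congr 1
      ext ω
      simp [Fin.ext_iff]
    · refine iIndepFun_comp_of_measurePreserving hfst (X := fun s ω => (ω s : ℕ))
        (fun s => by fun_prop) ?_
      exact iIndepFun_infinitePi (P := fun s : Fin m × ℕ => (c s.1).delayLaw)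
        (X := fun s x => (x : ℕ)) fun s => measurable_from_top
  · refine ⟨fun k => by fun_prop, ?_, ?_, ?_, ?_, ?_⟩
    · refine iIndepFun_comp_of_measurePreserving hsnd (X := fun k ω => ω k) (fun k => by fun_prop) ?_
      exact iIndepFun_infinitePi (P := fun _ : ℕ => γ) (X := fun _ x => x) fun _ => measurable_id
    · exact fun k => ⟨(hev k).measurable.aemeasurable, (hev 0).measurable.aemeasurable,
        (hev k).map_eq.trans (hev 0).map_eq.symm⟩
    · exact fun k i => (memLp_id_gaussianReal (μ := 0) (v := 1) 2).comp_measurePreserving (hev' k i)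
    · intro k i
      rw [hint k i (fun x => x) measurable_id, integral_id_gaussianReal]
    · intro k i j hij
      have h1 : ∫ ω, ω.2 k i * ω.2 k j ∂(μ₁.prod μ₂) = ∫ x, x i * x j ∂γ := by
        rw [← (hev k).map_eq, integral_map (hev k).measurable.aemeasurable]
        exact Measurable.aestronglyMeasurable (by fun_prop)
      have hi : IndepFun (fun x : Fin m → ℝ => x i) (fun x => x j) γ :=
        (iIndepFun_pi (μ := fun _ : Fin m => gaussianReal 0 1) (X := fun _ x => x)
          fun _ => aemeasurable_id).indepFun hij
      have h2 : ∫ x, x i ∂γ = 0 := by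
        have h3 := hint k i (fun x => x) measurable_id
        rw [integral_id_gaussianReal] at h3
        rw [← h3, ← (hev k).map_eq, integral_map (hev k).measurable.aemeasurable
          (measurable_pi_apply i).aestronglyMeasurable]
      rw [h1, hi.integral_fun_mul_eq_mul_integral (measurable_pi_apply i).aestronglyMeasurable
        (measurable_pi_apply j).aestronglyMeasurable, h2, zero_mul]
  · exact (indepFun_prod (X := fun ω : (s : Fin m × ℕ) → Fin ((c s.1).maxDelay + 1) =>
      fun i k => (ω (i, k) : ℕ)) (Y := id) (by fun_prop) measurable_id).symm
  · intro k i
    rw [hint k i (fun x => x ^ 2) (by fun_prop)]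
    have h1 := variance_id_gaussianReal (μ := 0) (v := 1)
    rw [variance_eq_integral measurable_id.aemeasurable] at h1
    simpa [integral_id_gaussianReal] using h1

/-! ### The criterion for mean-square stability -/

section Criterion

theorem sum_prob_mul_dev (c : Channel) (j : ℕ) :
    ∑ x ∈ Finset.range (c.maxDelay + 1), c.prob x * c.dev x j = 0 := by
  unfold Channel.dev
  split_ifs
  · simp only [mul_sub, Finset.sum_sub_distrib, ← Finset.sum_mul, c.prob_sum, one_mul]
    rw [Channel.mean, sub_self]
  · simp

theorem sum_prob_mul_pulseResponse (f : RatFunc ℝ) (c : Channel) (s : ℕ) :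
    ∑ x ∈ Finset.range (c.maxDelay + 1), c.prob x * pulseResponse f c x s = 0 := by
  simp only [pulseResponse, coeff_mul_eq_sum_range, Finset.mul_sum]
  rw [Finset.sum_comm]
  refine Finset.sum_eq_zero fun n _ => ?_
  simp only [mul_left_comm (Channel.prob c _)]
  rw [← Finset.mul_sum, sum_prob_mul_dev, mul_zero]

/-- Off-diagonal moments are controlled by `|x y| ≤ (x² + y²) / 2`. -/
theorem boundedVariance_of_integral_sq_le {m : ℕ} {Ω : Type} [MeasurableSpace Ω] {μ : Measure Ω}
    {x : ℕ → Ω → Fin m → ℝ} (hx : ∀ k i, MemLp (fun ω => x k ω i) 2 μ) {C : ℝ}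
    (hC : ∀ k i, ∫ ω, x k ω i ^ 2 ∂μ ≤ C) : BoundedVariance x μ := by
  refine ⟨C, fun k i j => ⟨(hx k i).integrable_mul (hx k j), ?_⟩⟩
  have hi := (hx k i).integrable_sq
  have hj := (hx k j).integrable_sq
  calc |∫ ω, x k ω i * x k ω j ∂μ| ≤ ∫ ω, |x k ω i * x k ω j| ∂μ := abs_integral_le_integral_abs
    _ ≤ ∫ ω, (1 / 2) * (x k ω i ^ 2 + x k ω j ^ 2) ∂μ := by
        refine integral_mono ((hx k i).integrable_mul (hx k j)).abs ((hi.add hj).const_mul _)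
          fun ω => ?_
        change |x k ω i * x k ω j| ≤ _
        rw [abs_mul]
        nlinarith [sq_nonneg (|x k ω i| - |x k ω j|), sq_abs (x k ω i), sq_abs (x k ω j)]
    _ = (1 / 2) * (∫ ω, x k ω i ^ 2 ∂μ + ∫ ω, x k ω j ^ 2 ∂μ) := by
        rw [integral_const_mul, integral_add hi hj]
    _ ≤ C := by linarith [hC k i, hC k j]

/-- The output of the zero-mean part of a channel has bounded variance if its input does. -/
theorem Channel.uncertaintyOutput_memLp_and_integral_sq_le {m : ℕ} {c : Fin m → Channel} {Ω : Type}
    [MeasurableSpace Ω] {μ : Measure Ω} {χ : Fin m → ℕ → Ω → ℕ} (hχ : IsDelayProcess c χ μ)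
    {u : ℕ → Ω → Fin m → ℝ} (hu : ∀ k i, MemLp (fun ω => u k ω i) 2 μ) {C : ℝ} (hC0 : 0 ≤ C)
    (hC : ∀ k i, ∫ ω, u k ω i ^ 2 ∂μ ≤ C) (i : Fin m) :
    ∃ B, ∀ k, MemLp (fun ω => (c i).uncertaintyOutput (fun n => χ i n ω) (fun l => u l ω i) k) 2 μ ∧
      ∫ ω, (c i).uncertaintyOutput (fun n => χ i n ω) (fun l => u l ω i) k ^ 2 ∂μ ≤ B := by
  set D : ℕ → ℝ := fun j => |(c i).weight j| + |(c i).mean j| with hD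
  have hdev : ∀ x j, |(c i).resp x j - (c i).mean j| ≤ D j := by
    intro x j
    refine (abs_sub _ _).trans (add_le_add ?_ le_rfl)
    unfold Channel.resp
    split_ifs
    · exact le_rfl
    · simp
  set t : ℕ → ℕ → Ω → ℝ := fun k j ω => if j ≤ k then
    ((c i).resp (χ i (k - j) ω) j - (c i).mean j) * u (k - j) ω i else 0 with ht
  have htm : ∀ k j, MemLp (t k j) 2 μ := by
    intro k j
    by_cases h : j ≤ k
    · simp only [ht, h, if_true]
      exact hχ.memLp_mul i (k - j) (fun x => (c i).resp x j - (c i).mean j) (hu (k - j) i)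
    · simp only [ht, h, if_false]
      exact MemLp.zero
  have htC : ∀ k j, ∫ ω, t k j ω ^ 2 ∂μ ≤ D j ^ 2 * C := by
    intro k j
    by_cases h : j ≤ k
    · calc ∫ ω, t k j ω ^ 2 ∂μ ≤ ∫ ω, D j ^ 2 * u (k - j) ω i ^ 2 ∂μ := by
            refine integral_mono (htm k j).integrable_sq ((hu (k - j) i).integrable_sq.const_mul _)
              fun ω => ?_
            simp only [ht, h, if_true, mul_pow]
            refine mul_le_mul_of_nonneg_right ?_ (sq_nonneg _)
            rw [← sq_abs]
            exact pow_le_pow_left₀ (abs_nonneg _) (hdev _ _) 2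
        _ ≤ D j ^ 2 * C := by
            rw [integral_const_mul]
            exact mul_le_mul_of_nonneg_left (hC _ _) (sq_nonneg _)
    · simp only [ht, h, if_false]
      simp
      positivity
  -- The bound comes from Cauchy–Schwarz for a sum of `maxDelay + 1` terms, each with deviation at
  -- most `D j`.
  refine ⟨((c i).maxDelay + 1 : ℕ) * ∑ j ∈ Finset.range ((c i).maxDelay + 1), D j ^ 2 * C,
    fun k => ⟨memLp_finsetSum _ fun j _ => htm k j, ?_⟩⟩
  have hs : ∀ j ∈ Finset.range ((c i).maxDelay + 1), Integrable (fun ω => t k j ω ^ 2) μ :=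
    fun j _ => (htm k j).integrable_sq
  calc ∫ ω, (c i).uncertaintyOutput (fun n => χ i n ω) (fun l => u l ω i) k ^ 2 ∂μ
      ≤ ∫ ω, ((c i).maxDelay + 1 : ℕ) * ∑ j ∈ Finset.range ((c i).maxDelay + 1), t k j ω ^ 2 ∂μ := by
        refine integral_mono ?_ ((integrable_finsetSum _ hs).const_mul _) fun ω => ?_
        · exact (memLp_finsetSum _ fun j _ => htm k j :
            MemLp (fun ω => ∑ j ∈ Finset.range ((c i).maxDelay + 1), t k j ω) 2 μ).integrable_sq
        · have := sq_sum_le_card_mul_sum_sq (s := Finset.range ((c i).maxDelay + 1))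
            (f := fun j => t k j ω)
          rw [Finset.card_range] at this
          exact this
    _ ≤ _ := by
        rw [integral_const_mul, integral_finsetSum _ hs]
        gcongr with j _
        exact htC k j

variable {m q : ℕ} {P : Matrix (Fin q) (Fin m) (RatFunc ℝ)} {K : Matrix (Fin m) (Fin q) (RatFunc ℝ)}
  {c : Fin m → Channel} {Φ : Fin m → Polynomial ℝ}

/-- With `T = G H` and `W = H⁻¹ Φ` the nominal channel cancels, leaving `G Φ`. Only the stability of
`G` matters, wherever the zeros of `H` lie. -/
theorem NominalInternallyStable.hasSum_momentKernel (h : NominalInternallyStable P K c)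
    (hH : ∀ i, (c i).nominal ≠ 0) (hΦ : ∀ i, (c i).IsSpectralFactor (Φ i)) (a b : Fin m) :
    HasSum (momentKernel (nominalFeedback P K c a b) (c b)) (hatTW P K c Φ a b) := by
  have h1 : complementarySensitivity P K c a b * (c b).freqVariation (Φ b) =
      nominalFeedback P K c a b * algebraMap (Polynomial ℝ) (RatFunc ℝ) (Φ b) := by
    have h2 : complementarySensitivity P K c a b =
        nominalFeedback P K c a b * (c b).nominal := by
      rw [complementarySensitivity, nominalChannel, Matrix.mul_diagonal, nominalFeedback]
    rw [h2, Channel.freqVariation, mul_assoc, mul_inv_cancel_left₀ (hH b)]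
  rw [hatTW, Matrix.of_apply, h1]
  exact (h.KSP a b).hasSum_momentKernel (hΦ b)

/-- The second moments of the control signal solve a Volterra equation. -/
theorem integral_control_sq (h : NominalInternallyStable P K c)
    (hP : ∀ i j, IsStrictlyProper (P i j)) (hK : ∀ i j, IsProper (K i j))
    {Ω : Type} [MeasurableSpace Ω] {μ : Measure Ω} [IsProbabilityMeasure μ]
    {χ : Fin m → ℕ → Ω → ℕ} {v e u : ℕ → Ω → Fin m → ℝ} {y : ℕ → Ω → Fin q → ℝ}
    (hχ : IsDelayProcess c χ μ) (hv : IsWhiteNoise v μ)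
    (hind : IndepFun (fun ω k => v k ω) (fun ω i k => χ i k ω) μ)
    (hl : ∀ ω, IsLoopPath P K c (fun i k => χ i k ω) (fun k => v k ω) (fun k => e k ω)
      (fun k => u k ω) (fun k => y k ω)) :
    (∀ k a, MemLp (fun ω => u k ω a) 2 μ) ∧
    ∀ k a, ∫ ω, u k ω a ^ 2 ∂μ =
      ∑ b, ∑ n ∈ Finset.range (k + 1),
        impulseResponse (nominalFeedback P K c a b) n ^ 2 * ∫ ω, v 0 ω b ^ 2 ∂μ +
      ∑ b, ∑ n ∈ Finset.range k,
        momentKernel (nominalFeedback P K c a b) (c b) (k - n) * ∫ ω, u n ω b ^ 2 ∂μ := by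
  have hrec : IsDelayRecursion (fun a b => impulseResponse (nominalFeedback P K c a b))
      (fun a b => pulseResponse (nominalFeedback P K c a b) (c b)) χ v u :=
    fun ω k a => (hl ω).control_eq h hP hK k a
  refine ⟨hrec.memLp hχ hv.memLp, fun k a => ?_⟩
  rw [hrec.integral_sq hχ hv hind (fun a b s => sum_prob_mul_pulseResponse _ _ s) k a]
  congr 1
  refine Finset.sum_congr rfl fun b _ => ?_
  rw [← Finset.sum_range_reflect]
  refine Finset.sum_congr rfl fun n hn => ?_
  have := Finset.mem_range.1 hn
  rw [show k + 1 - 1 - n = k - n by omega, show k - (k - n) = n by omega]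

theorem MeanSquareInternallyStable.spectralRadius_lt_one (h : MeanSquareInternallyStable P K c)
    (hP : ∀ i j, IsStrictlyProper (P i j)) (hK : ∀ i j, IsProper (K i j))
    (hH : ∀ i, (c i).nominal ≠ 0) (hΦ : ∀ i, (c i).IsSpectralFactor (Φ i)) :
    spectralRadius ℂ ((hatTW P K c Φ).map (algebraMap ℝ ℂ)) < 1 := by
  obtain ⟨hN, hMS⟩ := h
  obtain ⟨Ω, mΩ, μ, hμ, χ, v, hχ, hv, hind, hv1⟩ := exists_delayProcess_whiteNoise c
  choose e u y hl using fun ω => exists_isLoopPath hP K c (fun i k => χ i k ω) (fun k => v k ω)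
  obtain ⟨-, B, hB⟩ := hMS Ω μ χ v (fun k ω => e ω k) (fun k ω => u ω k) (fun k ω => y ω k)
    hχ hv hind hl
  obtain ⟨-, hrec⟩ := integral_control_sq (e := fun k ω => e ω k) (u := fun k ω => u ω k)
    (y := fun k ω => y ω k) hN hP hK hχ hv hind hl
  simp only [hv1, mul_one] at hrec
  refine spectralRadius_lt_one_of_volterra_bounded (C := B)
    (Γ := fun a b => momentKernel (nominalFeedback P K c a b) (c b))
    (f := fun k a => ∑ b, ∑ n ∈ Finset.range (k + 1),
      impulseResponse (nominalFeedback P K c a b) n ^ 2)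
    (x := fun k a => ∫ ω, u ω k a ^ 2 ∂μ)
    (fun a b s => momentKernel_nonneg _ _ s) (fun a b => ?_)
    (fun a b => hN.hasSum_momentKernel hH hΦ a b) (fun k a => integral_nonneg fun ω => sq_nonneg _)
    (fun a k l hkl => ?_) (fun a => ?_) hrec (fun k a => ?_)
  · simp [momentKernel, pulseResponse, PowerSeries.coeff_mul, hN.impulseResponse_zero hP]
  · exact Finset.sum_le_sum fun b _ => Finset.sum_le_sum_of_subset_of_nonneg
      (Finset.range_mono (by omega)) fun _ _ _ => sq_nonneg _
  -- Under unit-variance noise a row is never forced only if that row of `G` is zero, and then its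
  -- kernels vanish too.
  · by_cases h0 : ∀ b n, impulseResponse (nominalFeedback P K c a b) n = 0
    · right
      intro b s
      have : transferSeries (nominalFeedback P K c a b) = 0 := by
        ext n
        simp [h0 b n]
      simp [momentKernel, pulseResponse, this]
    · left
      push Not at h0
      obtain ⟨b, n, hbn⟩ := h0
      refine ⟨n, Finset.sum_pos' (fun b _ => Finset.sum_nonneg fun _ _ => sq_nonneg _)
        ⟨b, Finset.mem_univ b, Finset.sum_pos' (fun _ _ => sq_nonneg _)
          ⟨n, Finset.self_mem_range_succ n, by positivity⟩⟩⟩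
  · have := (le_abs_self _).trans (hB k a a).2
    simpa only [sq] using this

theorem NominalInternallyStable.meanSquareInternallyStable (h : NominalInternallyStable P K c)
    (hP : ∀ i j, IsStrictlyProper (P i j)) (hK : ∀ i j, IsProper (K i j))
    (hH : ∀ i, (c i).nominal ≠ 0) (hΦ : ∀ i, (c i).IsSpectralFactor (Φ i))
    (hρ : spectralRadius ℂ ((hatTW P K c Φ).map (algebraMap ℝ ℂ)) < 1) :
    MeanSquareInternallyStable P K c := by
  refine ⟨h, fun Ω _ μ _ χ v e u y hχ hv hind hl => ?_⟩
  obtain ⟨hum, hrec⟩ := integral_control_sq h hP hK hχ hv hind hl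
  set σ : Fin m → ℝ := fun b => ∫ ω, v 0 ω b ^ 2 ∂μ with hσ
  have hσ0 : ∀ b, 0 ≤ σ b := fun b => integral_nonneg fun ω => sq_nonneg _
  have hg0 : ∀ a b, 0 ≤ ∑' n, impulseResponse (nominalFeedback P K c a b) n ^ 2 := fun a b =>
    tsum_nonneg fun _ => sq_nonneg _
  obtain ⟨C, hC⟩ := volterra_bounded (x := fun k a => ∫ ω, u k ω a ^ 2 ∂μ)
    (Γ := fun a b => momentKernel (nominalFeedback P K c a b) (c b))
    -- The forcing is at most the energy of the impulse responses times the noise variances; summing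
    -- over rows gives one bound for all of them.
    (B := ∑ a, ∑ b, (∑' n, impulseResponse (nominalFeedback P K c a b) n ^ 2) * σ b)
    (fun a b s => momentKernel_nonneg _ _ s) (fun a b => h.hasSum_momentKernel hH hΦ a b) hρ
    (Finset.sum_nonneg fun a _ => Finset.sum_nonneg fun b _ => mul_nonneg (hg0 a b) (hσ0 b))
    (fun k a => by
      rw [hrec k a]
      refine add_le_add ?_ le_rfl
      refine le_trans ?_ (Finset.single_le_sum
        (f := fun a => ∑ b, (∑' n, impulseResponse (nominalFeedback P K c a b) n ^ 2) * σ b)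
        (fun a _ => Finset.sum_nonneg fun b _ => mul_nonneg (hg0 a b) (hσ0 b)) (Finset.mem_univ a))
      refine Finset.sum_le_sum fun b _ => ?_
      rw [← Finset.sum_mul]
      exact mul_le_mul_of_nonneg_right
        ((h.KSP a b).summable_sq.sum_le_tsum _ fun _ _ => sq_nonneg _) (hσ0 b))
  have hC' : ∀ k a, ∫ ω, u k ω a ^ 2 ∂μ ≤ max C 0 := fun k a => (hC k a).trans (le_max_left _ _)
  refine ⟨?_, boundedVariance_of_integral_sq_le hum hC'⟩
  choose B hB using fun i =>
    Channel.uncertaintyOutput_memLp_and_integral_sq_le hχ hum (le_max_right C 0) hC' i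
  set d : ℕ → Ω → Fin m → ℝ := fun k ω i =>
    (c i).uncertaintyOutput (fun n => χ i n ω) (fun l => u l ω i) k with hd
  have he : ∀ k ω i, e k ω i = v k ω i - d k ω i := fun k ω i => (hl ω).error k i
  have hdm : ∀ k i, MemLp (fun ω => d k ω i) 2 μ := fun k i => (hB i k).1
  have hem : ∀ k i, MemLp (fun ω => e k ω i) 2 μ := fun k i => by
    simp only [he]
    exact (hv.memLp k i).sub (hdm k i)
  have hB0 : ∀ i, 0 ≤ B i := fun i => (integral_nonneg fun ω => sq_nonneg _).trans (hB i 0).2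
  refine boundedVariance_of_integral_sq_le (C := ∑ i, (2 * σ i + 2 * B i)) hem fun k i => ?_
  refine le_trans ?_ (Finset.single_le_sum (f := fun i => 2 * σ i + 2 * B i)
    (fun i _ => by linarith [hσ0 i, hB0 i]) (Finset.mem_univ i))
  have hvi := (hv.memLp k i).integrable_sq
  have hdi := (hdm k i).integrable_sq
  calc ∫ ω, e k ω i ^ 2 ∂μ ≤ ∫ ω, (2 * v k ω i ^ 2 + 2 * d k ω i ^ 2) ∂μ := by
        refine integral_mono (hem k i).integrable_sq ((hvi.const_mul 2).add (hdi.const_mul 2))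
          fun ω => ?_
        simp only [he]
        nlinarith [sq_nonneg (v k ω i + d k ω i)]
    _ = 2 * σ i + 2 * ∫ ω, d k ω i ^ 2 ∂μ := by
        rw [integral_add (hvi.const_mul 2) (hdi.const_mul 2), integral_const_mul,
          integral_const_mul, hv.integral_sq]
    _ ≤ 2 * σ i + 2 * B i := by linarith [(hB i k).2]

end Criterion

end RandomDelay

theorem theorem1 {m q : ℕ}
    (P : Matrix (Fin q) (Fin m) (RatFunc ℝ)) (K : Matrix (Fin m) (Fin q) (RatFunc ℝ))
    (c : Fin m → RandomDelay.Channel) (Φ : Fin m → Polynomial ℝ)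
    (hP : ∀ i j, RandomDelay.IsStrictlyProper (P i j))
    (hK : ∀ i j, RandomDelay.IsProper (K i j))
    (hH : ∀ i, (c i).nominal ≠ 0)
    (hΦ : ∀ i, (c i).IsSpectralFactor (Φ i)) :
    RandomDelay.MeanSquareInternallyStable P K c ↔
      RandomDelay.NominalInternallyStable P K c ∧
        spectralRadius ℂ ((RandomDelay.hatTW P K c Φ).map (algebraMap ℝ ℂ)) < 1 :=
  ⟨fun h => ⟨h.1, h.spectralRadius_lt_one hP hK hH hΦ⟩,
    fun h => h.1.meanSquareInternallyStable hP hK hH hΦ h.2⟩
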